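/- **Setting.** Let $\Omega=\{0,1\}^{\mathbb N}$ ($\mathbb N\ni 0$) with the product topology and the shift $\sigma$. For a sequence $a=(a_n)$ of positive numbers strictly decreasing to $0$, let $d_a$ be the ultrametric on $\Omega$ with $d_a(x,y)=a_m$, where $m$ is the first position at which $x\neq y$ differ, and let $C^a(\Omega)$ be the Banach space of real $d_a$-Lipschitz functions with the norm $\|f\|_\infty+\mathrm{Lip}_a(f)$. A maximizing measure of $f$ is a $\sigma$-invariant Borel probability measure that maximizes $\int f\,d\mu$ over all such measures; a periodic measure is a $\sigma$-invariant Borel probability measure supported on a periodic orbit. Let $\mathsf L_a\subset C^a(\Omega)$ be the set of $f$ with the locking property: $f$ has a unique maximizing measure $\mu$, $\mu$ is periodic, and $\mu$ is the unique maximizing measure of every $g\in C^a(\Omega)$ sufficiently close to $f$ in the norm of $C^a(\Omega)$. The sequence $a$ is *evanescent* if it is positive, strictly decreasing to $0$, and $a_{n+1}/a_n=O(2^{-2^{n+2}})$. Let $\Omega^*$ be the set of finite words in $0,1$ (including the empty word), $|\omega|$ the length of $\omega$, $[\omega]\subset\Omega$ the cylinder of sequences with initial subword $\omega$, and $h_\omega=\tfrac12(\chi_{[\omega0]}-\chi_{[\omega1]})$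 the Haar functions. A gauge is a family $b=(b_\omega)_{\omega\in\Omega^*}$ of positive numbers; it is *admissible* with respect to $a$ if $$\max_{|\omega|=n}b_\omega=o(a_n)\quad\text{and}\quad \log\Bigl(a_n\big/\min_{|\omega|=n}b_\omega\Bigr)=O(n)\qquad(n\to\infty).$$ The Hilbert brick is $\mathcal H_b=\bigl\{\sum_n\sum_{|\omega|=n}c_\omega h_\omega : |c_\omega|\le b_\omega \text{ for all }\omega\bigr\}$, with uniformly convergent series, and $\mathbb P_b$ is the law of $\sum_n\sum_{|\omega|=n} c_\omega h_\omega$ when the $c_\omega$ are independent and $c_\omega$ is uniformly distributed on $[-b_\omega,b_\omega]$. A Borel probability measure $\mathbb P$ on a completely metrizable vector space $V$ is *transverse* to a Borel set $S\subset V$ if it is compactly supported and $\mathbb P(S+v)=0$ for every $v\in V$. **Theorem 1.3.** Let $a$ be an evanescent sequence and $b$ an admissible gauge with respect to $a$. Then, for all coefficients with $|c_\omega|\le b_\omega$, the series $\sum_n\sum_{|\omega|=n}c_\omega h_\omega$ converges uniformly to an element of $C^a(\Omega)$; $\mathcal H_b$ is a compact subset of $C^a(\Omega)$; $\mathbb P_b$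 is a Borel probability measure on $C^a(\Omega)$ with $\mathbb P_b(\mathcal H_b)=1$; and for every $f_0\in C^a(\Omega)$, $$\mathbb P_b\bigl(\{g\in\mathcal H_b : f_0+g\in\mathsf L_a\}\bigr)=1 .$$ Hence $\mathbb P_b$ is transverse to the complement of $\mathsf L_a$ in $C^a(\Omega)$. -/

import Mathlib

open MeasureTheory Filter Topology Asymptotics

noncomputable section

namespace ErgOpt

/-! ### Transverse measures -/

/-- A Borel probability measure `P` on a completely metrizable vector space `V` is transverse to a
Borel set `S` if `P` is compactly supported and every translate of `S` is `P`-null. -/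
structure IsTransverse {V : Type*} [AddCommGroup V] [Module ℝ V] [TopologicalSpace V]
    [IsTopologicalAddGroup V] [ContinuousSMul ℝ V] [TopologicalSpace.IsCompletelyMetrizableSpace V]
    [MeasurableSpace V] [BorelSpace V] (P : Measure V) (S : Set V) : Prop where
  borel : MeasurableSet S
  prob : IsProbabilityMeasure P
  compactly_supported : ∃ K : Set V, IsCompact K ∧ P Kᶜ = 0
  null_translates : ∀ v : V, P ((fun s => s + v) '' S) = 0

/-! ### Ergodic optimization -/

section ErgodicOptimization

variable {X : Type*} [MeasurableSpace X]

/-- The set of `T`-invariant probability measures. -/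
def invMeasures (T : X → X) : Set (Measure X) :=
  {μ | IsProbabilityMeasure μ ∧ MeasurePreserving T μ μ}

/-- The ergodic supremum of `f`: the supremum of `∫ f dμ` over the invariant probabilities `μ`. -/
def ergSup (T : X → X) (f : X → ℝ) : ℝ :=
  sSup ((fun μ : Measure X => ∫ x, f x ∂μ) '' invMeasures T)

/-- `μ` is a maximizing measure for `f`. -/
def IsMaximizing (T : X → X) (f : X → ℝ) (μ : Measure X) : Prop :=
  μ ∈ invMeasures T ∧ ∫ x, f x ∂μ = ergSup T f

/-- `μ` is the unique maximizing measure for `f`. -/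
def IsUniqueMaximizing (T : X → X) (f : X → ℝ) (μ : Measure X) : Prop :=
  IsMaximizing T f μ ∧ ∀ ν, IsMaximizing T f ν → ν = μ

/-- `μ` is an invariant probability measure supported on the orbit of some periodic point. -/
def IsPeriodicMeasure (T : X → X) (μ : Measure X) : Prop :=
  μ ∈ invMeasures T ∧
    ∃ x ∈ Function.periodicPts T, μ (Set.range fun k : ℕ => T^[k] x)ᶜ = 0

end ErgodicOptimization

/-! ### The one-sided shift on two symbols and the spaces of Lipschitz functions -/

/-- The symbolic space `{0,1}^ℕ`, with the product topology and its Borel σ-algebra. -/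
abbrev Om : Type := ℕ → Fin 2

/-- The shift `(x₀, x₁, x₂, …) ↦ (x₁, x₂, …)`. -/
def shift (x : Om) : Om := fun n => x (n + 1)

open Classical in
/-- The ultrametric `d_a`: `d_a x y = a m`, where `m` is the least position at which `x` and `y`
differ, and `d_a x x = 0`. -/
def seqDist (a : ℕ → ℝ) (x y : Om) : ℝ :=
  if x = y then 0 else a (PiNat.firstDiff x y)

/-- The nonnegative Lipschitz constants of `f` with respect to `d_a`. -/
def lipBounds (a : ℕ → ℝ) (f : C(Om, ℝ)) : Set ℝ :=
  {K | 0 ≤ K ∧ ∀ x y, |f x - f y| ≤ K * seqDist a x y}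

lemma lipBounds_add {a : ℕ → ℝ} {f g : C(Om, ℝ)} {K L : ℝ} (hf : K ∈ lipBounds a f)
    (hg : L ∈ lipBounds a g) : K + L ∈ lipBounds a (f + g) := by
  refine ⟨add_nonneg hf.1 hg.1, fun x y => ?_⟩
  have h : (f + g) x - (f + g) y = (f x - f y) + (g x - g y) := by
    simp only [ContinuousMap.add_apply]; ring
  rw [h, add_mul]
  exact (abs_add_le _ _).trans (add_le_add (hf.2 x y) (hg.2 x y))

lemma lipBounds_smul {a : ℕ → ℝ} {f : C(Om, ℝ)} {K : ℝ} (c : ℝ) (hf : K ∈ lipBounds a f) :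
    |c| * K ∈ lipBounds a (c • f) := by
  refine ⟨mul_nonneg (abs_nonneg c) hf.1, fun x y => ?_⟩
  have h : (c • f) x - (c • f) y = c * (f x - f y) := by
    simp only [ContinuousMap.smul_apply, smul_eq_mul]; ring
  rw [h, abs_mul, mul_assoc]
  exact mul_le_mul_of_nonneg_left (hf.2 x y) (abs_nonneg c)

lemma lipBounds_zero (a : ℕ → ℝ) : (0 : ℝ) ∈ lipBounds a 0 :=
  ⟨le_rfl, fun x y => by simp⟩

/-- The continuous functions that are Lipschitz with respect to `d_a`, as a linear subspace. -/
def lipSubmodule (a : ℕ → ℝ) : Submodule ℝ C(Om, ℝ) where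
  carrier := {f | (lipBounds a f).Nonempty}
  add_mem' := fun ⟨_, hK⟩ ⟨_, hL⟩ => ⟨_, lipBounds_add hK hL⟩
  zero_mem' := ⟨0, lipBounds_zero a⟩
  smul_mem' := fun c _ ⟨_, hK⟩ => ⟨_, lipBounds_smul c hK⟩

/-- The space `C^a(Ω)` of `d_a`-Lipschitz functions, normed below by the Lipschitz norm. -/
def LipSpace (a : ℕ → ℝ) : Type := ↥(lipSubmodule a)

instance (a : ℕ → ℝ) : AddCommGroup (LipSpace a) :=
  inferInstanceAs (AddCommGroup ↥(lipSubmodule a))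

instance (a : ℕ → ℝ) : Module ℝ (LipSpace a) :=
  inferInstanceAs (Module ℝ ↥(lipSubmodule a))

/-- The continuous function underlying an element of `C^a(Ω)`. -/
def LipSpace.toC {a : ℕ → ℝ} (f : LipSpace a) : C(Om, ℝ) := Subtype.val f

/-- The least Lipschitz constant with respect to `d_a`. -/
def lipConst {a : ℕ → ℝ} (f : LipSpace a) : ℝ := sInf (lipBounds a f.toC)

lemma bddBelow_lipBounds (a : ℕ → ℝ) (f : C(Om, ℝ)) : BddBelow (lipBounds a f) :=
  ⟨0, fun _ h => h.1⟩

lemma lipConst_mem {a : ℕ → ℝ} (f : LipSpace a) : lipConst f ∈ lipBounds a f.toC := by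
  have hcl : IsClosed (lipBounds a f.toC) := by
    have : lipBounds a f.toC = Set.Ici 0 ∩ ⋂ x, ⋂ y,
        {K : ℝ | |f.toC x - f.toC y| ≤ K * seqDist a x y} := by
      ext K; simp [lipBounds]
    rw [this]
    exact isClosed_Ici.inter (isClosed_iInter fun x => isClosed_iInter fun y =>
      isClosed_le continuous_const (continuous_id.mul continuous_const))
  exact hcl.csInf_mem f.2 (bddBelow_lipBounds a _)

/-- The Lipschitz norm: the sup norm plus the least Lipschitz constant. -/
instance (a : ℕ → ℝ) : Norm (LipSpace a) := ⟨fun f => ‖f.toC‖ + lipConst f⟩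

lemma LipSpace.norm_def {a : ℕ → ℝ} (f : LipSpace a) : ‖f‖ = ‖f.toC‖ + lipConst f := rfl

lemma lipConst_add_le {a : ℕ → ℝ} (f g : LipSpace a) :
    lipConst (f + g) ≤ lipConst f + lipConst g :=
  csInf_le (bddBelow_lipBounds a _) (lipBounds_add (lipConst_mem f) (lipConst_mem g))

lemma lipConst_smul_le {a : ℕ → ℝ} (c : ℝ) (f : LipSpace a) :
    lipConst (c • f) ≤ |c| * lipConst f :=
  csInf_le (bddBelow_lipBounds a _) (lipBounds_smul c (lipConst_mem f))

lemma lipSpace_core (a : ℕ → ℝ) : NormedSpace.Core ℝ (LipSpace a) where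
  norm_nonneg f := add_nonneg (norm_nonneg _) (lipConst_mem f).1
  norm_smul c f := by
    have hsup : ‖(c • f).toC‖ = |c| * ‖f.toC‖ := norm_smul c f.toC
    have hlip : lipConst (c • f) = |c| * lipConst f := by
      refine le_antisymm (lipConst_smul_le c f) ?_
      rcases eq_or_ne c 0 with rfl | hc
      · simpa using (lipConst_mem ((0 : ℝ) • f)).1
      · have h := lipConst_smul_le c⁻¹ (c • f)
        rw [smul_smul, inv_mul_cancel₀ hc, one_smul, abs_inv] at h
        calc |c| * lipConst f ≤ |c| * (|c|⁻¹ * lipConst (c • f)) :=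
              mul_le_mul_of_nonneg_left h (abs_nonneg c)
          _ = lipConst (c • f) := by rw [mul_inv_cancel_left₀ (abs_ne_zero.2 hc)]
    rw [LipSpace.norm_def, LipSpace.norm_def, hsup, hlip, Real.norm_eq_abs]; ring
  norm_triangle f g := by
    have h1 : ‖(f + g).toC‖ ≤ ‖f.toC‖ + ‖g.toC‖ := norm_add_le f.toC g.toC
    have h2 := lipConst_add_le f g
    rw [LipSpace.norm_def, LipSpace.norm_def, LipSpace.norm_def]; linarith
  norm_eq_zero_iff f := by
    constructor
    · intro h
      have h2 := (lipConst_mem f).1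
      have h3 := norm_nonneg f.toC
      rw [LipSpace.norm_def] at h
      exact Subtype.ext (norm_eq_zero.1 (show ‖f.toC‖ = 0 by linarith))
    · rintro rfl
      have h1 : ‖(0 : LipSpace a).toC‖ = 0 := norm_zero
      have h2 : lipConst (0 : LipSpace a) = 0 :=
        le_antisymm (csInf_le (bddBelow_lipBounds a _) (lipBounds_zero a)) (lipConst_mem _).1
      rw [LipSpace.norm_def, h1, h2, add_zero]

instance (a : ℕ → ℝ) : NormedAddCommGroup (LipSpace a) :=
  NormedAddCommGroup.ofCore (lipSpace_core a)

instance (a : ℕ → ℝ) : NormedSpace ℝ (LipSpace a) :=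
  NormedSpace.ofCore (lipSpace_core a)

instance (a : ℕ → ℝ) : CompleteSpace (LipSpace a) := by
  classical
  -- only relevant for sequences `a` with negative terms
  set c : ℝ → ℝ := fun K => if ∃ x y, seqDist a x y < 0 then 0 else K with hc
  have hc0 : ∀ K, 0 ≤ K → 0 ≤ c K ∧ c K ≤ K := fun K hK => by
    by_cases h : ∃ x y, seqDist a x y < 0
    · simp only [hc, if_pos h]; exact ⟨le_rfl, hK⟩
    · simp only [hc, if_neg h]; exact ⟨hK, le_rfl⟩
  have key : ∀ (f : LipSpace a) (K : ℝ), lipConst f ≤ K → ∀ x y,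
      |f.toC x - f.toC y| ≤ c K * seqDist a x y := by
    intro f K hK x y
    obtain ⟨h0, h1⟩ := lipConst_mem f
    by_cases h : ∃ x y, seqDist a x y < 0
    · obtain ⟨x', y', h'⟩ := h
      have hz : lipConst f = 0 := by
        refine le_antisymm ?_ h0
        by_contra! hpos
        have := mul_neg_of_pos_of_neg hpos h'
        linarith [h1 x' y', abs_nonneg (f.toC x' - f.toC y')]
      have h2 := h1 x y
      simp only [hc, if_pos (show ∃ x y, seqDist a x y < 0 from ⟨x', y', h'⟩)]
      rwa [hz] at h2
    · simp only [hc, if_neg h]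
      push Not at h
      exact (h1 x y).trans (mul_le_mul_of_nonneg_right hK (h x y))
  refine Metric.complete_of_cauchySeq_tendsto fun u hu => ?_
  have hu' : ∀ ε > 0, ∃ N, ∀ n ≥ N, ∀ m ≥ N, ‖u n - u m‖ < ε := fun ε hε => by
    obtain ⟨N, hN⟩ := Metric.cauchySeq_iff.1 hu ε hε
    exact ⟨N, fun n hn m hm => by rw [← dist_eq_norm]; exact hN n hn m hm⟩
  have hcau : CauchySeq fun n => (u n).toC := by
    refine Metric.cauchySeq_iff.2 fun ε hε => ?_
    obtain ⟨N, hN⟩ := hu' ε hε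
    refine ⟨N, fun n hn m hm => ?_⟩
    have h1 := hN n hn m hm
    have h2 := (lipConst_mem (u n - u m)).1
    rw [LipSpace.norm_def] at h1
    rw [dist_eq_norm]
    have h3 : (u n - u m).toC = (u n).toC - (u m).toC := rfl
    rw [← h3]; linarith
  obtain ⟨F, hF⟩ := cauchySeq_tendsto_of_complete hcau
  have hpt : ∀ x, Tendsto (fun n => (u n).toC x) atTop (𝓝 (F x)) := fun x =>
    ((continuous_eval_const (F := C(Om, ℝ)) x).tendsto F).comp hF
  have hlim : ∀ ε > 0, ∃ N, ∀ n ≥ N, ε ⊓ c ε ∈ lipBounds a ((u n).toC - F) := by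
    intro ε hε
    obtain ⟨N, hN⟩ := hu' ε hε
    refine ⟨N, fun n hn => ?_⟩
    rw [inf_eq_right.2 (hc0 ε hε.le).2]
    refine ⟨(hc0 ε hε.le).1, fun x y => ?_⟩
    have ht : Tendsto (fun m => |(u n - u m).toC x - (u n - u m).toC y|) atTop
        (𝓝 |((u n).toC - F) x - ((u n).toC - F) y|) :=
      (((tendsto_const_nhds.sub (hpt x)).sub (tendsto_const_nhds.sub (hpt y))).abs)
    refine le_of_tendsto ht ?_
    filter_upwards [eventually_ge_atTop N] with m hm
    refine key (u n - u m) ε ?_ x y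
    have h1 := hN n hn m hm
    rw [LipSpace.norm_def] at h1
    linarith [norm_nonneg (u n - u m).toC]
  have hFmem : F ∈ lipSubmodule a := by
    obtain ⟨N, hN⟩ := hlim 1 one_pos
    have h1 : (u N).toC - F ∈ lipSubmodule a := ⟨_, hN N le_rfl⟩
    have h2 := (lipSubmodule a).sub_mem (show (u N).toC ∈ lipSubmodule a from (u N).2) h1
    rwa [sub_sub_cancel] at h2
  let G : LipSpace a := ⟨F, hFmem⟩
  refine ⟨G, Metric.tendsto_atTop.2 fun ε hε => ?_⟩
  obtain ⟨N₁, hN₁⟩ := hlim (ε / 3) (by positivity)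
  obtain ⟨N₂, hN₂⟩ := Metric.tendsto_atTop.1 hF (ε / 3) (by positivity)
  refine ⟨max N₁ N₂, fun n hn => ?_⟩
  have h1 : lipConst (u n - G) ≤ ε / 3 :=
    (csInf_le (bddBelow_lipBounds a _) (hN₁ n (le_of_max_le_left hn))).trans inf_le_left
  have h2 := hN₂ n (le_of_max_le_right hn)
  rw [dist_eq_norm] at h2 ⊢
  have h3 : (u n - G).toC = (u n).toC - F := rfl
  rw [LipSpace.norm_def, h3]
  linarith

instance (a : ℕ → ℝ) : MeasurableSpace (LipSpace a) := borel _

instance (a : ℕ → ℝ) : BorelSpace (LipSpace a) := ⟨rfl⟩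

/-- The set `L_a` of functions `f` in `C^a(Ω)` with the locking property: some periodic measure is
the unique maximizing measure of `f` and of every function sufficiently close to `f` in the
Lipschitz norm. -/
def lockingSet (a : ℕ → ℝ) : Set (LipSpace a) :=
  {f | ∃ μ : Measure Om, IsPeriodicMeasure shift μ ∧ IsUniqueMaximizing shift f.toC μ ∧
    ∃ ε > 0, ∀ g : LipSpace a, ‖g - f‖ < ε → IsUniqueMaximizing shift g.toC μ}

/-- Evanescent sequences: strictly decreasing sequences of positive numbers that converge to zero,
with `a (n+1) / a n = O(2^(-2^(n+2)))`. -/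
structure Evanescent (a : ℕ → ℝ) : Prop where
  pos : ∀ n, 0 < a n
  strictAnti : StrictAnti a
  tendsto_zero : Tendsto a atTop (𝓝 0)
  ratio : (fun n => a (n + 1) / a n) =O[atTop] fun n => ((2 : ℝ) ^ 2 ^ (n + 2))⁻¹

/-! ### Haar series and Hilbert bricks -/

/-- Finite words in the letters `0`, `1`, including the empty word. -/
abbrev Word : Type := List (Fin 2)

/-- Words of length `n`. -/
abbrev WordOf (n : ℕ) : Type := List.Vector (Fin 2) n

/-- The cylinder `[w]`: the sequences that have `w` as an initial subword. -/
def wordCyl (w : Word) : Set Om := {x | ∀ i : Fin w.length, x i = w.get i}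

lemma isClopen_wordCyl (w : Word) : IsClopen (wordCyl w) := by
  have : wordCyl w = ⋂ i : Fin w.length, (fun x : Om => x i) ⁻¹' {w.get i} := by
    ext x; simp [wordCyl]
  rw [this]
  exact isClopen_iInter_of_finite fun i => (isClopen_discrete _).preimage (continuous_apply _)

/-- The characteristic function of a cylinder. -/
def charFn (w : Word) : C(Om, ℝ) :=
  ⟨(wordCyl w).indicator fun _ => 1, continuous_const.indicator fun x hx => by
    simp [(isClopen_wordCyl w).frontier_eq] at hx⟩

/-- The Haar function `h_w = (χ_[w0] - χ_[w1]) / 2`. -/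
def haar (w : Word) : C(Om, ℝ) := (1 / 2 : ℝ) • (charFn (w ++ [0]) - charFn (w ++ [1]))

/-- `f` is the sum of the Haar series `∑_n ∑_{|w| = n} c_w h_w`, which converges uniformly. -/
def HasHaarSum (c : Word → ℝ) (f : C(Om, ℝ)) : Prop :=
  HasSum (fun n : ℕ => ∑ w : WordOf n, c w.toList • haar w.toList) f

/-- The product `∏_w [-b_w, b_w]`. -/
def coeffBox (b : Word → ℝ) : Set (Word → ℝ) := {c | ∀ w, |c w| ≤ b w}

/-- The Hilbert brick: the functions in `C^a(Ω)` that are sums of Haar series `∑ c_w h_w` with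
`|c_w| ≤ b_w` for all `w`. -/
def hilbertBrick (a : ℕ → ℝ) (b : Word → ℝ) : Set (LipSpace a) :=
  {f | ∃ c ∈ coeffBox b, HasHaarSum c f.toC}

open Classical in
/-- The element of `C^a(Ω)` given by the Haar series with coefficients `c` (zero if the series
does not represent an element of `C^a(Ω)`). -/
def haarSeries (a : ℕ → ℝ) (c : Word → ℝ) : LipSpace a :=
  if h : ∃ f : LipSpace a, HasHaarSum c f.toC then h.choose else 0

/-- Product of the normalized Lebesgue measures on the intervals `[-b_w, b_w]`. -/
def coeffMeasure (b : Word → ℝ) : Measure (Word → ℝ) :=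
  Measure.infinitePi fun w => ProbabilityTheory.cond volume (Set.Icc (-b w) (b w))

/-- The law `P_b` on `C^a(Ω)` of the Haar series with independent random coefficients, the
coefficient `c_w` being uniformly distributed on `[-b_w, b_w]`. -/
def brickMeasure (a : ℕ → ℝ) (b : Word → ℝ) : Measure (LipSpace a) :=
  (coeffMeasure b).map (haarSeries a)

/-- `max_{|w| = n} b_w`. -/
def gaugeMax (b : Word → ℝ) (n : ℕ) : ℝ := ⨆ w : WordOf n, b w.toList

/-- `min_{|w| = n} b_w`. -/
def gaugeMin (b : Word → ℝ) (n : ℕ) : ℝ := ⨅ w : WordOf n, b w.toList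

/-- Gauges (families of positive numbers indexed by words) that are admissible with respect
to `a`. -/
structure AdmissibleGauge (a : ℕ → ℝ) (b : Word → ℝ) : Prop where
  pos : ∀ w, 0 < b w
  max_isLittleO : gaugeMax b =o[atTop] a
  log_isBigO : (fun n => Real.log (a n / gaugeMin b n)) =O[atTop] fun n : ℕ => (n : ℝ)

end ErgOpt

end

open ErgOpt

noncomputable section

namespace ErgOpt

/-! Fix a scale `M` and sample `f` at one point of each cylinder of length `M + 1`. This gives
weights on the edges of the de Bruijn graph whose vertices are the words of length `M`. By cutting
simple loops out of walks, the maximal growth of Birkhoff sums of such weights is the largest mean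
over simple cycles (`exists_simpleLoop_excision`, `exists_birkhoffSum_le`).

If one simple cycle beats all the others by more than a fixed multiple of `a (M + 1)`, then `f` is
locked on the corresponding periodic orbit (`IsSimpleLoop.isUniqueMaximizing_of_gap`,
`mem_lockingSet_of_gap`). The required margin does not involve the length of the cycle. A point that
follows the loop for a long time is very close to its orbit, so the error of replacing `f` by edge
weights can be charged to the visits outside the loop, and the tails of `a` are summable with sum
`O(a m)`.

If there is no such margin, two nearly optimal simple cycles differ at some edge `e`
(`exists_gap_of_not_nearTie`). Let `w` be the initial vertex of `e`. Varying the coefficient of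
`h_w` moves the mean of a simple cycle through `e` in one direction at speed at least `2^{-M} / 2`,
and never moves the mean of a cycle avoiding `e` in that direction. Hence a near tie of size `ε`
confines `c_w` to a set of diameter `O(2^M ε)` once the other coefficients are fixed
(`NearTie.abs_sub_le`).

Fubini and a union bound over the `2^{M+1}` edges, with `ε` comparable to `a (M + 1)`, bound the
probability of not being locked by a constant times `4^M a (M + 1) / min b_w`, the minimum being
over `|w| = M`. The lower bound on the gauge costs a factor exponential in `M`, while evanescence
gains a double exponential, so the bound tends to `0` (`tendsto_pow_mul_div_gaugeMin`). The event
does not depend on `M`, hence it is null. -/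

/-! ### Tail sums of evanescent sequences and the ultrametric -/

lemma Evanescent.exists_sum_le {a : ℕ → ℝ} (ha : Evanescent a) :
    ∃ K > 0, ∀ m k, ∑ j ∈ Finset.range k, a (m + j) ≤ K * a m := by
  have hlim : Tendsto (fun n : ℕ => ((2 : ℝ) ^ 2 ^ (n + 2))⁻¹) atTop (𝓝 0) := by
    refine tendsto_inv_atTop_zero.comp ((tendsto_pow_atTop_atTop_of_one_lt one_lt_two).comp ?_)
    exact (tendsto_pow_atTop_atTop_of_one_lt one_lt_two).comp (tendsto_add_atTop_nat 2)
  have h0 := ha.ratio.trans_tendsto hlim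
  obtain ⟨N, hN⟩ := eventually_atTop.1 (h0.eventually_lt_const (show (0 : ℝ) < 1 / 2 by norm_num))
  have hhalf : ∀ m ≥ N, 2 * a (m + 1) ≤ a m := fun m hm => by
    have h := hN m hm
    rw [div_lt_iff₀ (ha.pos m)] at h
    linarith
  have hsucc : ∀ m k, ∑ j ∈ Finset.range (k + 1), a (m + j)
      = a m + ∑ j ∈ Finset.range k, a (m + 1 + j) := fun m k => by
    rw [Finset.sum_range_succ', add_comm]
    simp [add_assoc, add_comm 1]
  have htail : ∀ k, ∀ m ≥ N, ∑ j ∈ Finset.range k, a (m + j) ≤ 2 * a m := by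
    intro k
    induction k with
    | zero => intro m _; simpa using (ha.pos m).le
    | succ k ih =>
      intro m hm
      rw [hsucc]
      linarith [ih (m + 1) (by omega), hhalf m hm]
  -- Before index `N` there is no halving. Each of the `d` steps back from `N` adds one term `a m`
  -- and otherwise uses monotonicity.
  have hall : ∀ d m k, N ≤ m + d → ∑ j ∈ Finset.range k, a (m + j) ≤ (d + 2) * a m := by
    intro d
    induction d with
    | zero => intro m k h; simpa using htail k m (by omega)
    | succ d ih =>
      intro m k h
      have hpos := ha.pos m
      cases k with
      | zero => simp only [Finset.range_zero, Finset.sum_empty]; positivity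
      | succ k =>
        rw [hsucc]
        have h1 := ih (m + 1) k (by omega)
        have h2 : ((d : ℝ) + 2) * a (m + 1) ≤ (d + 2) * a m :=
          mul_le_mul_of_nonneg_left (ha.strictAnti (Nat.lt_succ_self m)).le (by positivity)
        push_cast
        linarith
  exact ⟨N + 2, by positivity, fun m k => hall N m k (by omega)⟩

lemma Evanescent.seqDist_nonneg {a : ℕ → ℝ} (ha : Evanescent a) (x y : Om) :
    0 ≤ seqDist a x y := by
  unfold seqDist
  split_ifs
  · exact le_rfl
  · exact (ha.pos _).le

/-- Points that agree on their first `m` symbols are at distance at most `a m`. -/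
lemma Evanescent.seqDist_le {a : ℕ → ℝ} (ha : Evanescent a) {x y : Om} {m : ℕ}
    (h : ∀ i < m, x i = y i) : seqDist a x y ≤ a m := by
  unfold seqDist
  split_ifs with hxy
  · exact (ha.pos _).le
  · refine ha.strictAnti.antitone ?_
    by_contra! hlt
    exact PiNat.apply_firstDiff_ne hxy (h _ hlt)

/-! ### Haar series -/

/-- The value `±1/2` of the Haar functions of level `n` on their supports. -/
def haarSign (i : Fin 2) : ℝ := if i = 0 then 1 / 2 else -1 / 2

lemma abs_haarSign (i : Fin 2) : |haarSign i| = 1 / 2 := by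
  unfold haarSign
  split_ifs <;> norm_num [abs_div]

/-- The initial word of length `n`. -/
def prefixWord (n : ℕ) (x : Om) : Word := List.ofFn fun i : Fin n => x i

@[simp] lemma length_prefixWord (n : ℕ) (x : Om) : (prefixWord n x).length = n := by
  simp [prefixWord]

lemma prefixWord_congr {n : ℕ} {x y : Om} (h : ∀ i < n, x i = y i) :
    prefixWord n x = prefixWord n y := by
  unfold prefixWord
  congr 1
  ext i
  rw [h i i.2]

lemma mem_wordCyl_iff (w : Word) (x : Om) : x ∈ wordCyl w ↔ w = prefixWord w.length x := by
  constructor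
  · intro h
    refine List.ext_get (by simp) fun i h1 h2 => ?_
    have := h ⟨i, h1⟩
    simp only [prefixWord, List.get_eq_getElem, List.getElem_ofFn] at this ⊢
    exact this.symm
  · intro h i
    have h1 : w.get i = (prefixWord w.length x).get ⟨i, by simp⟩ := by
      simp only [List.get_eq_getElem]
      congr 1
    rw [h1]
    simp [prefixWord]

lemma charFn_append (w : Word) (i : Fin 2) (x : Om) :
    charFn (w ++ [i]) x = if w = prefixWord w.length x ∧ x w.length = i then 1 else 0 := by
  have h : x ∈ wordCyl (w ++ [i]) ↔ w = prefixWord w.length x ∧ x w.length = i := by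
    rw [mem_wordCyl_iff]
    have hl : prefixWord (w ++ [i]).length x = prefixWord w.length x ++ [x w.length] := by
      rw [List.length_append, List.length_singleton]
      simp only [prefixWord, List.ofFn_succ_last]
      simp
    rw [hl]
    refine ⟨fun h => ?_, fun h => by rw [← h.1, h.2]⟩
    have h2 := List.append_inj' h rfl
    exact ⟨h2.1, (List.singleton_inj.1 h2.2).symm⟩
  change (wordCyl (w ++ [i])).indicator (fun _ => (1 : ℝ)) x = _
  classical
  rw [Set.indicator_apply]
  simp only [h]

lemma haar_apply (w : Word) (x : Om) :
    haar w x = if w = prefixWord w.length x then haarSign (x w.length) else 0 := by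
  simp only [haar, ContinuousMap.smul_apply, ContinuousMap.sub_apply, charFn_append, smul_eq_mul,
    haarSign]
  by_cases h : w = prefixWord w.length x
  · have h2 : x w.length = 0 ∨ x w.length = 1 := by omega
    rcases h2 with h0 | h0
    · rw [h0]; simp [← h]
    · rw [h0]; simp [← h]; norm_num
  · simp [h]

/-- The cylinders of the words of length `n` are disjoint, so only the prefix of `x` contributes. -/
lemma haar_level_apply (c : Word → ℝ) (n : ℕ) (x : Om) :
    (∑ w : WordOf n, c w.toList • haar w.toList) x
      = c (prefixWord n x) * haarSign (x n) := by
  rw [ContinuousMap.sum_apply]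
  refine (Fintype.sum_eq_single (α := WordOf n) ⟨prefixWord n x, by simp⟩ ?_).trans ?_
  · intro w hw
    have hl : w.toList.length = n := w.2
    rw [ContinuousMap.smul_apply, haar_apply, if_neg, smul_zero]
    rw [hl]
    intro h
    exact hw (Subtype.ext h)
  · simp [haar_apply, List.Vector.toList]

lemma norm_haar_level_le {c : Word → ℝ} {n : ℕ} {B : ℝ}
    (hc : ∀ w : Word, w.length = n → |c w| ≤ B) :
    ‖∑ w : WordOf n, c w.toList • haar w.toList‖ ≤ B := by
  have hB : 0 ≤ B := (abs_nonneg _).trans (hc (prefixWord n fun _ => 0) (by simp))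
  refine (ContinuousMap.norm_le _ hB).2 fun x => ?_
  rw [haar_level_apply, Real.norm_eq_abs, abs_mul, abs_haarSign]
  linarith [hc (prefixWord n x) (by simp), abs_nonneg (c (prefixWord n x))]

lemma HasHaarSum.hasSum_apply {c : Word → ℝ} {f : C(Om, ℝ)} (h : HasHaarSum c f) (x : Om) :
    HasSum (fun n => c (prefixWord n x) * haarSign (x n)) (f x) := by
  have h1 := (show HasSum _ f from h).map (ContinuousMap.evalCLM ℝ x)
    (ContinuousMap.evalCLM ℝ x).continuous
  refine h1.congr_fun ?_ |> fun h => by simpa using h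
  intro n
  simp [← haar_level_apply]

lemma HasHaarSum.add {c d : Word → ℝ} {f g : C(Om, ℝ)} (hf : HasHaarSum c f)
    (hg : HasHaarSum d g) : HasHaarSum (c + d) (f + g) := by
  have h := HasSum.add hf hg
  simpa only [HasHaarSum, Pi.add_apply, add_smul, Finset.sum_add_distrib] using h

lemma HasHaarSum.sub {c d : Word → ℝ} {f g : C(Om, ℝ)} (hf : HasHaarSum c f)
    (hg : HasHaarSum d g) : HasHaarSum (c - d) (f - g) := by
  have h := HasSum.sub hf hg
  simpa only [HasHaarSum, Pi.sub_apply, sub_smul, Finset.sum_sub_distrib] using h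

lemma hasHaarSum_single (w : Word) (s : ℝ) : HasHaarSum (Pi.single w s) (s • haar w) := by
  have h : ∀ n, n ≠ w.length →
      ∑ v : WordOf n, (Pi.single w s : Word → ℝ) v.toList • haar v.toList = 0 := by
    intro n hn
    refine Finset.sum_eq_zero fun v _ => ?_
    rw [Pi.single_eq_of_ne, zero_smul]
    rintro rfl
    exact hn v.2.symm
  have h2 : ∑ v : WordOf w.length, (Pi.single w s : Word → ℝ) v.toList • haar v.toList
      = s • haar w := by
    refine (Fintype.sum_eq_single (α := WordOf w.length) ⟨w, rfl⟩ ?_).trans ?_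
    · intro v hv
      rw [Pi.single_eq_of_ne, zero_smul]
      exact fun h => hv (Subtype.ext h)
    · simp [List.Vector.toList]
  unfold HasHaarSum
  rw [← h2]
  exact hasSum_single _ h

section Series

variable {a : ℕ → ℝ} {K : ℝ}

lemma summable_of_sum_le (ha : Evanescent a)
    (hK : ∀ m k, ∑ j ∈ Finset.range k, a (m + j) ≤ K * a m) : Summable a :=
  summable_of_sum_range_le (fun n => (ha.pos n).le) fun n => by simpa using hK 0 n

/-- A Haar series whose coefficients are dominated by a multiple of `a` converges uniformly to an
element of `C^a(Ω)`, whose norm is controlled by this multiple. -/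
lemma exists_hasHaarSum (ha : Evanescent a)
    (hK : ∀ m k, ∑ j ∈ Finset.range k, a (m + j) ≤ K * a m) {c : Word → ℝ} {M : ℝ}
    (hc : ∀ w, |c w| ≤ M * a w.length) :
    ∃ f : LipSpace a, HasHaarSum c f.toC ∧ ‖f‖ ≤ M * (K * (a 0 + 1)) := by
  have hM : 0 ≤ M := nonneg_of_mul_nonneg_left ((abs_nonneg _).trans (hc [])) (ha.pos _)
  have hK0 : 0 ≤ K := by
    have := hK 0 0
    simp only [Finset.range_zero, Finset.sum_empty] at this
    exact nonneg_of_mul_nonneg_left this (ha.pos _)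
  have hterm : ∀ n x, |c (prefixWord n x) * haarSign (x n)| ≤ M * a n / 2 := fun n x => by
    rw [abs_mul, abs_haarSign]
    have := hc (prefixWord n x)
    rw [length_prefixWord] at this
    linarith
  have hsummable : Summable fun n : ℕ => ∑ w : WordOf n, c w.toList • haar w.toList := by
    refine Summable.of_norm_bounded ((summable_of_sum_le ha hK).mul_left M) fun n => ?_
    refine norm_haar_level_le fun w hw => ?_
    rw [← hw]
    exact hc w
  obtain ⟨F, hF⟩ := hsummable
  have hF : HasHaarSum c F := hF
  have hlip : M * K ∈ lipBounds a F := by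
    refine ⟨mul_nonneg hM hK0, fun x y => ?_⟩
    by_cases hxy : x = y
    · subst hxy; simp [seqDist]
    set m := PiNat.firstDiff x y with hm
    have hd : seqDist a x y = a m := by simp [seqDist, hxy, hm]
    have hagree : ∀ i < m, x i = y i := fun i hi => PiNat.apply_eq_of_lt_firstDiff hi
    rw [hd]
    have hs := ((hF.hasSum_apply x).sub (hF.hasSum_apply y)).tendsto_sum_nat
    refine le_of_tendsto ((tendsto_add_atTop_iff_nat m).2 hs).abs
      (Eventually.of_forall fun k => ?_)
    -- Levels below `m` depend only on the common initial word of `x` and `y` and cancel. The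
    -- remaining levels form a tail starting at `a m`.
    rw [add_comm k m, Finset.sum_range_add, Finset.sum_eq_zero, zero_add]
    · refine (Finset.abs_sum_le_sum_abs _ _).trans ?_
      calc _ ≤ ∑ j ∈ Finset.range k, M * a (m + j) := Finset.sum_le_sum fun j _ => by
            refine (abs_sub _ _).trans ?_
            linarith [hterm (m + j) x, hterm (m + j) y]
        _ ≤ M * K * a m := by
            rw [← Finset.mul_sum, mul_assoc]
            exact mul_le_mul_of_nonneg_left (hK m k) hM
    · intro i hi
      rw [Finset.mem_range] at hi
      rw [hagree i hi, prefixWord_congr fun j hj => hagree j (hj.trans hi), sub_self]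
  have hsup : ‖F‖ ≤ M * K * a 0 := by
    refine (ContinuousMap.norm_le _ (by have := ha.pos 0; positivity)).2 fun x => ?_
    refine le_of_tendsto (hF.hasSum_apply x).tendsto_sum_nat.norm
      (Eventually.of_forall fun k => ?_)
    refine (norm_sum_le _ _).trans ?_
    calc _ ≤ ∑ j ∈ Finset.range k, M * a (0 + j) := Finset.sum_le_sum fun j _ => by
          rw [Real.norm_eq_abs, zero_add]
          have := mul_nonneg hM (ha.pos j).le
          linarith [hterm j x]
      _ ≤ M * K * a 0 := by
          rw [← Finset.mul_sum, mul_assoc]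
          exact mul_le_mul_of_nonneg_left (hK 0 k) hM
  obtain ⟨f, rfl⟩ : ∃ f : LipSpace a, f.toC = F := ⟨⟨F, ⟨_, hlip⟩⟩, rfl⟩
  refine ⟨f, hF, ?_⟩
  rw [LipSpace.norm_def]
  have h1 : lipConst f ≤ M * K := csInf_le (bddBelow_lipBounds a _) hlip
  linarith

lemma LipSpace.toC_injective : Function.Injective (LipSpace.toC (a := a)) := Subtype.val_injective

lemma HasHaarSum.unique {c : Word → ℝ} {f g : LipSpace a} (hf : HasHaarSum c f.toC)
    (hg : HasHaarSum c g.toC) : f = g :=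
  LipSpace.toC_injective (HasSum.unique hf hg)

lemma HasHaarSum.haarSeries_eq {c : Word → ℝ} {f : LipSpace a} (hf : HasHaarSum c f.toC) :
    haarSeries a c = f := by
  have h : ∃ f : LipSpace a, HasHaarSum c f.toC := ⟨f, hf⟩
  rw [haarSeries, dif_pos h]
  exact h.choose_spec.unique hf

end Series

/-! ### Admissible gauges and compactness of the brick -/

lemma le_gaugeMax (b : Word → ℝ) (w : Word) : b w ≤ gaugeMax b w.length :=
  le_ciSup (f := fun v : WordOf w.length => b v.toList) (Set.finite_range _).bddAbove ⟨w, rfl⟩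

lemma gaugeMin_le (b : Word → ℝ) (w : Word) : gaugeMin b w.length ≤ b w :=
  ciInf_le (f := fun v : WordOf w.length => b v.toList) (Set.finite_range _).bddBelow ⟨w, rfl⟩

section Gauge

variable {a : ℕ → ℝ} {b : Word → ℝ}

lemma AdmissibleGauge.gaugeMin_pos (hb : AdmissibleGauge a b) (n : ℕ) : 0 < gaugeMin b n := by
  obtain ⟨w, hw⟩ := exists_eq_ciInf_of_finite (f := fun v : WordOf n => b v.toList)
  rw [gaugeMin, ← hw]
  exact hb.pos _

lemma AdmissibleGauge.eventually_le (ha : Evanescent a) (hb : AdmissibleGauge a b) {ε : ℝ}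
    (hε : 0 < ε) : ∃ N, ∀ w : Word, N ≤ w.length → b w ≤ ε * a w.length := by
  obtain ⟨N, hN⟩ := eventually_atTop.1 (hb.max_isLittleO.bound hε)
  refine ⟨N, fun w hw => ?_⟩
  have h := hN _ hw
  rw [Real.norm_eq_abs, Real.norm_eq_abs, abs_of_pos (ha.pos _)] at h
  exact (le_gaugeMax b w).trans ((le_abs_self _).trans h)

lemma AdmissibleGauge.exists_le (ha : Evanescent a) (hb : AdmissibleGauge a b) :
    ∃ B > 0, ∀ w : Word, b w ≤ B * a w.length := by
  obtain ⟨N, hN⟩ := hb.eventually_le ha one_pos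
  obtain ⟨B, hB⟩ := ((List.finite_length_lt (Fin 2) N).image fun w => b w / a w.length).bddAbove
  refine ⟨max B 1, by positivity, fun w => ?_⟩
  by_cases hw : w.length < N
  · have h := hB ⟨w, hw, rfl⟩
    rw [div_le_iff₀ (ha.pos _)] at h
    exact h.trans (mul_le_mul_of_nonneg_right (le_max_left _ _) (ha.pos _).le)
  · exact (hN w (by omega)).trans (mul_le_mul_of_nonneg_right (le_max_right _ _) (ha.pos _).le)

lemma exists_hasHaarSum_of_mem_coeffBox (ha : Evanescent a) (hb : AdmissibleGauge a b) :
    ∃ R : ℝ, ∀ c ∈ coeffBox b, ∃ f : LipSpace a, HasHaarSum c f.toC ∧ ‖f‖ ≤ R := by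
  obtain ⟨K, -, hK⟩ := ha.exists_sum_le
  obtain ⟨B, -, hB⟩ := hb.exists_le ha
  exact ⟨_, fun c hc => exists_hasHaarSum ha hK fun w => (hc w).trans (hB w)⟩

lemma hasHaarSum_haarSeries (ha : Evanescent a) (hb : AdmissibleGauge a b) {c : Word → ℝ}
    (hc : c ∈ coeffBox b) : HasHaarSum c (haarSeries a c).toC := by
  obtain ⟨R, hR⟩ := exists_hasHaarSum_of_mem_coeffBox ha hb
  obtain ⟨f, hf, -⟩ := hR c hc
  rwa [hf.haarSeries_eq]

lemma exists_norm_haarSeries_le (ha : Evanescent a) (hb : AdmissibleGauge a b) :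
    ∃ R : ℝ, ∀ c ∈ coeffBox b, ‖haarSeries a c‖ ≤ R := by
  obtain ⟨R, hR⟩ := exists_hasHaarSum_of_mem_coeffBox ha hb
  refine ⟨R, fun c hc => ?_⟩
  obtain ⟨f, hf, hle⟩ := hR c hc
  rwa [hf.haarSeries_eq]

lemma hilbertBrick_eq_image (ha : Evanescent a) (hb : AdmissibleGauge a b) :
    hilbertBrick a b = haarSeries a '' coeffBox b := by
  ext f
  constructor
  · rintro ⟨c, hc, hf⟩
    exact ⟨c, hc, hf.haarSeries_eq⟩
  · rintro ⟨c, hc, rfl⟩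
    exact ⟨c, hc, hasHaarSum_haarSeries ha hb hc⟩

lemma coeffBox_eq_pi (b : Word → ℝ) :
    coeffBox b = Set.pi Set.univ fun w => Set.Icc (-b w) (b w) := by
  ext c
  simp only [coeffBox, abs_le, Set.mem_ofPred_eq, Set.mem_univ_pi, Set.mem_Icc]

lemma isCompact_coeffBox (b : Word → ℝ) : IsCompact (coeffBox b) := by
  rw [coeffBox_eq_pi]
  exact isCompact_univ_pi fun _ => isCompact_Icc

/-- The product topology controls only finitely many coefficients. The condition `b = o(a)` makes
all the others uniformly small relative to `a`, which is what the Lipschitz norm requires.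
Compactness and measurability of the brick follow from this. -/
lemma continuousOn_haarSeries (ha : Evanescent a) (hb : AdmissibleGauge a b) :
    ContinuousOn (haarSeries a) (coeffBox b) := by
  obtain ⟨K, hK0, hK⟩ := ha.exists_sum_le
  have hC : 0 < K * (a 0 + 1) := by have := ha.pos 0; positivity
  intro c hc
  refine Metric.tendsto_nhds.2 fun ε hε => ?_
  set η := ε / 2 / (K * (a 0 + 1)) with hη
  have hη0 : 0 < η := by positivity
  obtain ⟨N, hN⟩ := hb.eventually_le ha (half_pos hη0)
  have hnear : ∀ᶠ d in 𝓝 c, ∀ w ∈ {w : Word | w.length < N}, |d w - c w| < η * a w.length := by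
    refine (eventually_all_finite (List.finite_length_lt (Fin 2) N)).2 fun w _ => ?_
    have h1 : Tendsto (fun d : Word → ℝ => |d w - c w|) (𝓝 c) (𝓝 |c w - c w|) :=
      (((continuous_apply w).tendsto c).sub_const _).abs
    rw [sub_self, abs_zero] at h1
    exact h1.eventually_lt_const (mul_pos hη0 (ha.pos _))
  filter_upwards [nhdsWithin_le_nhds hnear, self_mem_nhdsWithin] with d hd hdb
  have hle : ∀ w, |(d - c) w| ≤ η * a w.length := fun w => by
    by_cases hw : w.length < N
    · exact (hd w hw).le
    · have h1 := hN w (by omega)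
      refine (abs_sub _ _).trans ?_
      linarith [hdb w, hc w]
  obtain ⟨f, hf, hfn⟩ := exists_hasHaarSum ha hK hle
  have h2 : HasHaarSum (d - c) (haarSeries a d - haarSeries a c).toC :=
    (hasHaarSum_haarSeries ha hb hdb).sub (hasHaarSum_haarSeries ha hb hc)
  rw [dist_eq_norm, h2.unique hf]
  refine hfn.trans_lt ?_
  rw [hη, div_mul_cancel₀ _ hC.ne']
  linarith

lemma isCompact_hilbertBrick (ha : Evanescent a) (hb : AdmissibleGauge a b) :
    IsCompact (hilbertBrick a b) := by
  rw [hilbertBrick_eq_image ha hb]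
  exact (isCompact_coeffBox b).image_of_continuousOn (continuousOn_haarSeries ha hb)

lemma isProbabilityMeasure_cond_Icc {r : ℝ} (hr : 0 < r) :
    IsProbabilityMeasure (ProbabilityTheory.cond volume (Set.Icc (-r) r)) := by
  refine ProbabilityTheory.cond_isProbabilityMeasure_of_finite ?_ ?_ <;> simp [Real.volume_Icc]
  linarith

end Gauge

/-! ### Windows, simple loops and cycle means on de Bruijn graphs -/

lemma shift_iterate_apply (k : ℕ) (x : Om) (m : ℕ) : shift^[k] x m = x (m + k) := by
  induction k generalizing x with
  | zero => rfl
  | succ k ih => rw [Function.iterate_succ_apply, ih]; rfl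

lemma continuous_shift : Continuous shift :=
  continuous_pi fun n => continuous_apply (n + 1)

/-- The first `n` symbols. -/
def window (n : ℕ) (x : Om) : Fin n → Fin 2 := fun i => x i

lemma measurable_window (n : ℕ) : Measurable (window n) :=
  measurable_pi_lambda _ fun i => measurable_pi_apply (i : ℕ)

lemma window_eq_iff {n : ℕ} {x y : Om} : window n x = window n y ↔ ∀ i < n, x i = y i :=
  ⟨fun h i hi => congrFun h ⟨i, hi⟩, fun h => funext fun i => h i i.2⟩

/-- The edges of the de Bruijn graph whose vertices are the words of length `M`. -/
abbrev Edge (M : ℕ) : Type := Fin (M + 1) → Fin 2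

/-- `p` is a point of period `L` whose orbit describes a simple loop in the de Bruijn graph with
vertices the words of length `M`. -/
structure IsSimpleLoop (M : ℕ) (p : Om) (L : ℕ) : Prop where
  pos : 0 < L
  period : shift^[L] p = p
  inj : Set.InjOn (fun i => window M (shift^[i] p)) (Set.Iio L)

/-- The edges visited by the orbit of `p` up to time `L`. -/
def loopEdges (M : ℕ) (p : Om) (L : ℕ) : Finset (Edge M) :=
  (Finset.range L).image fun i => window (M + 1) (shift^[i] p)

open Classical in
/-- The edge sets of the simple loops. -/
def simpleCycles (M : ℕ) : Finset (Finset (Edge M)) :=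
  Finset.univ.filter fun C => ∃ p L, IsSimpleLoop M p L ∧ C = loopEdges M p L

lemma mem_simpleCycles {M : ℕ} {C : Finset (Edge M)} :
    C ∈ simpleCycles M ↔ ∃ p L, IsSimpleLoop M p L ∧ C = loopEdges M p L := by
  simp [simpleCycles]

/-- The average of the edge weight `F` over `C`. -/
def cycleMean {M : ℕ} (F : Edge M → ℝ) (C : Finset (Edge M)) : ℝ := (∑ e ∈ C, F e) / C.card

section Loop

variable {M L : ℕ} {p : Om}

lemma window_eq_of_window_succ_eq {x y : Om} (h : window (M + 1) x = window (M + 1) y) :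
    window M x = window M y :=
  window_eq_iff.2 fun i hi => window_eq_iff.1 h i (by omega)

lemma window_shift_eq_of_window_succ_eq {x y : Om} (h : window (M + 1) x = window (M + 1) y) :
    window M (shift x) = window M (shift y) :=
  window_eq_iff.2 fun i hi => window_eq_iff.1 h (i + 1) (by omega)

lemma IsSimpleLoop.injOn_edges (h : IsSimpleLoop M p L) :
    Set.InjOn (fun i => window (M + 1) (shift^[i] p)) (Finset.range L) := fun i hi j hj hij =>
  h.inj (by simpa using hi) (by simpa using hj) (window_eq_of_window_succ_eq hij)

lemma IsSimpleLoop.sum_loopEdges (h : IsSimpleLoop M p L) (F : Edge M → ℝ) :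
    ∑ e ∈ loopEdges M p L, F e = ∑ i ∈ Finset.range L, F (window (M + 1) (shift^[i] p)) :=
  Finset.sum_image h.injOn_edges

lemma IsSimpleLoop.card_loopEdges (h : IsSimpleLoop M p L) : (loopEdges M p L).card = L := by
  rw [loopEdges, Finset.card_image_of_injOn h.injOn_edges, Finset.card_range]

lemma IsSimpleLoop.le_two_pow (h : IsSimpleLoop M p L) : L ≤ 2 ^ M := by
  have h1 := Finset.card_le_univ ((Finset.range L).image fun i => window M (shift^[i] p))
  rw [Finset.card_image_of_injOn (by simpa [Finset.coe_range] using h.inj)] at h1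
  simpa using h1

lemma IsSimpleLoop.cycleMean_eq (h : IsSimpleLoop M p L) (F : Edge M → ℝ) :
    cycleMean F (loopEdges M p L)
      = (∑ i ∈ Finset.range L, F (window (M + 1) (shift^[i] p))) / L := by
  rw [cycleMean, h.sum_loopEdges, h.card_loopEdges]

lemma IsSimpleLoop.mem_simpleCycles (h : IsSimpleLoop M p L) :
    loopEdges M p L ∈ simpleCycles M :=
  ErgOpt.mem_simpleCycles.2 ⟨p, L, h, rfl⟩

/-- An edge of a simple loop is determined by its initial vertex. -/
lemma IsSimpleLoop.eq_of_init_eq (h : IsSimpleLoop M p L) {e e' : Edge M}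
    (he : e ∈ loopEdges M p L) (he' : e' ∈ loopEdges M p L)
    (hee : ∀ i : Fin M, e i.castSucc = e' i.castSucc) : e = e' := by
  obtain ⟨i, hi, rfl⟩ := Finset.mem_image.1 he
  obtain ⟨j, hj, rfl⟩ := Finset.mem_image.1 he'
  have : i = j := h.inj (by simpa using hi) (by simpa using hj) (funext fun r => hee r)
  rw [this]

end Loop

/-- A walk in the de Bruijn graph can be shortened by a simple loop as soon as it is longer than
the number of vertices. -/
lemma exists_simpleLoop_excision (M : ℕ) (x : Om) :
    ∃ (p y : Om) (L : ℕ), IsSimpleLoop M p L ∧ ∀ (F : Edge M → ℝ) (k : ℕ), 2 ^ M ≤ k →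
      ∑ i ∈ Finset.range k, F (window (M + 1) (shift^[i] x))
        = ∑ i ∈ Finset.range L, F (window (M + 1) (shift^[i] p))
          + ∑ i ∈ Finset.range (k - L), F (window (M + 1) (shift^[i] y)) := by
  classical
  -- Pigeonhole on the `2 ^ M` vertices. The earliest return time is selected below, so that the
  -- loop it closes is simple.
  have hex : ∃ j ≤ 2 ^ M, ∃ i < j, window M (shift^[i] x) = window M (shift^[j] x) := by
    obtain ⟨i, j, hij, h⟩ := Fintype.exists_ne_map_eq_of_card_lt
      (fun i : Fin (2 ^ M + 1) => window M (shift^[i] x)) (by simp)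
    rcases lt_or_gt_of_ne hij with hlt | hlt
    · exact ⟨j, by omega, i, hlt, h⟩
    · exact ⟨i, by omega, j, hlt, h.symm⟩
  have hex' : ∃ j, ∃ i < j, window M (shift^[i] x) = window M (shift^[j] x) := by
    obtain ⟨j, -, h⟩ := hex; exact ⟨j, h⟩
  obtain ⟨i, hij, hw⟩ := Nat.find_spec hex'
  have hmin : ∀ j' < Nat.find hex', ∀ i' < j',
      window M (shift^[i'] x) ≠ window M (shift^[j'] x) := fun j' hj' i' hi' he =>
    Nat.find_min hex' hj' ⟨i', hi', he⟩
  have hjM : Nat.find hex' ≤ 2 ^ M := by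
    obtain ⟨j, hj, h⟩ := hex
    exact (Nat.find_min' hex' h).trans hj
  generalize Nat.find hex' = j at hij hw hmin hjM
  obtain ⟨L, rfl⟩ := Nat.exists_eq_add_of_lt hij
  obtain ⟨L', hL'⟩ : ∃ L', L' = L + 1 := ⟨_, rfl⟩
  rw [add_assoc, ← hL'] at hw hmin hjM
  have hrep : ∀ s < M, x (s + i) = x (s + i + L') := fun s hs => by
    have := window_eq_iff.1 hw s hs
    rw [shift_iterate_apply, shift_iterate_apply] at this
    rw [this, add_assoc]
  -- The repeated vertex makes `x` periodic on a stretch long enough to contain every edge of the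
  -- loop.
  have hmod : ∀ s < L' + M, x (i + s % L') = x (i + s) := by
    intro s
    induction s using Nat.strong_induction_on with
    | _ s ih =>
      intro hs
      by_cases hsL : s < L'
      · rw [Nat.mod_eq_of_lt hsL]
      · have h1 := ih (s - L') (by omega) (by omega)
        have h2 := hrep (s - L') (by omega)
        rw [← Nat.mod_eq_sub_mod (by omega)] at h1
        rw [h1, add_comm i, h2]
        congr 1
        omega
  -- `p` repeats the loop forever; `y` is `x` with the loop cut out.
  set p : Om := fun m => x (i + m % L') with hp
  set y : Om := fun m => if m < i then x m else x (m + L') with hy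
  have hpw : ∀ m < L', window (M + 1) (shift^[m] p) = window (M + 1) (shift^[i + m] x) := by
    intro m hm
    refine window_eq_iff.2 fun r hr => ?_
    rw [shift_iterate_apply, shift_iterate_apply]
    change x (i + (r + m) % L') = _
    rw [hmod _ (by omega)]
    congr 1
    omega
  have hyw1 : ∀ m < i, window (M + 1) (shift^[m] y) = window (M + 1) (shift^[m] x) := by
    intro m hm
    refine window_eq_iff.2 fun r hr => ?_
    rw [shift_iterate_apply, shift_iterate_apply]
    simp only [hy]
    split_ifs with h
    · rfl
    · have := hrep (r + m - i) (by omega)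
      rw [show r + m - i + i = r + m by omega] at this
      exact this.symm
  have hyw2 : ∀ m, window (M + 1) (shift^[i + m] y) = window (M + 1) (shift^[i + L' + m] x) := by
    intro m
    refine window_eq_iff.2 fun r hr => ?_
    rw [shift_iterate_apply, shift_iterate_apply]
    simp only [hy]
    rw [if_neg (by omega)]
    congr 1
    omega
  refine ⟨p, y, L', ⟨by omega, ?_, ?_⟩, ?_⟩
  · funext m
    rw [shift_iterate_apply]
    simp [hp]
  · have key : ∀ m < L', ∀ m' < m, window M (shift^[m'] p) ≠ window M (shift^[m] p) := by
      intro m hm m' hm' he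
      rw [window_eq_of_window_succ_eq (hpw m hm),
        window_eq_of_window_succ_eq (hpw m' (by omega))] at he
      exact hmin (i + m) (by omega) (i + m') (by omega) he
    intro m hm m' hm' he
    rcases lt_trichotomy m m' with h | h | h
    · exact absurd he (key m' hm' m h)
    · exact h
    · exact absurd he.symm (key m hm m' h)
  · intro F k hk
    obtain ⟨q, rfl⟩ := Nat.exists_eq_add_of_le (hjM.trans hk)
    rw [show i + L' + q - L' = i + q by omega, Finset.sum_range_add, Finset.sum_range_add,
      Finset.sum_range_add]
    have h1 : ∑ m ∈ Finset.range L', F (window (M + 1) (shift^[m] p))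
        = ∑ m ∈ Finset.range L', F (window (M + 1) (shift^[i + m] x)) :=
      Finset.sum_congr rfl fun m hm => by rw [hpw m (Finset.mem_range.1 hm)]
    have h2 : ∑ m ∈ Finset.range i, F (window (M + 1) (shift^[m] y))
        = ∑ m ∈ Finset.range i, F (window (M + 1) (shift^[m] x)) :=
      Finset.sum_congr rfl fun m hm => by rw [hyw1 m (Finset.mem_range.1 hm)]
    rw [h1, h2]
    simp only [hyw2]
    ring

/-- If all simple cycles have mean at most `β`, then the Birkhoff sums are at most linear with
slope `β`. -/
lemma exists_birkhoffSum_le {M : ℕ} {F : Edge M → ℝ} {β : ℝ}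
    (h : ∀ C ∈ simpleCycles M, cycleMean F C ≤ β) :
    ∃ K, ∀ k x, ∑ i ∈ Finset.range k, F (window (M + 1) (shift^[i] x)) ≤ k * β + K := by
  set B := ∑ e, |F e - β| with hB
  have hFB : ∀ e, F e ≤ β + B := fun e => by
    have := Finset.single_le_sum (f := fun e => |F e - β|) (fun _ _ => abs_nonneg _)
      (Finset.mem_univ e)
    linarith [le_abs_self (F e - β)]
  have hB0 : 0 ≤ B := Finset.sum_nonneg fun _ _ => abs_nonneg _
  -- Excisions never exceed slope `β`. They stop when fewer than `2 ^ M` terms remain, each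
  -- exceeding `β` by at most `B`.
  refine ⟨2 ^ M * B, fun k => ?_⟩
  induction k using Nat.strong_induction_on with
  | _ k ih =>
    intro x
    by_cases hk : 2 ^ M ≤ k
    · obtain ⟨p, y, L, hp, hsum⟩ := exists_simpleLoop_excision M x
      rw [hsum F k hk]
      have h1 := h _ hp.mem_simpleCycles
      have hL : (0 : ℝ) < L := by exact_mod_cast hp.pos
      rw [hp.cycleMean_eq, div_le_iff₀ hL] at h1
      have hLk : L ≤ k := hp.le_two_pow.trans hk
      have h2 := ih (k - L) (by have := hp.pos; omega) y
      rw [Nat.cast_sub hLk] at h2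
      linarith
    · have h1 : ∑ i ∈ Finset.range k, F (window (M + 1) (shift^[i] x)) ≤ k * (β + B) := by
        refine (Finset.sum_le_sum fun i _ => hFB _).trans ?_
        simp [mul_add]
      have h2 : (k : ℝ) ≤ 2 ^ M := by exact_mod_cast (not_le.1 hk).le
      nlinarith

lemma integral_comp_iterate {μ : Measure Om} (hμ : μ ∈ invMeasures shift) {G : Om → ℝ}
    (hG : Measurable G) (k : ℕ) : ∫ x, G (shift^[k] x) ∂μ = ∫ x, G x ∂μ := by
  have h := hμ.2.iterate k
  conv_rhs => rw [← h.map_eq]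
  exact (integral_map h.measurable.aemeasurable hG.aestronglyMeasurable).symm

/-- By invariance a Birkhoff sum of length `k` integrates to `k` times the integral of `G`, and the
additive constant is negligible for large `k`. -/
lemma integral_le_of_birkhoffSum_le {μ : Measure Om} (hμ : μ ∈ invMeasures shift) {G : Om → ℝ}
    (hG : Measurable G) {R : ℝ} (hR : ∀ x, |G x| ≤ R) {β K : ℝ}
    (h : ∀ (k : ℕ) x, ∑ i ∈ Finset.range k, G (shift^[i] x) ≤ k * β + K) :
    ∫ x, G x ∂μ ≤ β := by
  have := hμ.1
  have hint : ∀ i, Integrable (fun x => G (shift^[i] x)) μ := fun i =>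
    Integrable.of_bound (hG.comp (hμ.2.iterate i).measurable).aestronglyMeasurable R
      (Eventually.of_forall fun x => hR _)
  have hk : ∀ k : ℕ, k * ∫ x, G x ∂μ ≤ k * β + K := fun k => by
    have h1 : ∫ x, ∑ i ∈ Finset.range k, G (shift^[i] x) ∂μ ≤ ∫ _, (k * β + K) ∂μ :=
      integral_mono (integrable_finsetSum _ fun i _ => hint i) (integrable_const _) (h k)
    rw [integral_finsetSum _ fun i _ => hint i] at h1
    simpa [integral_comp_iterate hμ hG] using h1
  by_contra! hlt
  obtain ⟨k, hk'⟩ := exists_nat_gt (K / (∫ x, G x ∂μ - β))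
  rw [div_lt_iff₀ (by linarith)] at hk'
  linarith [hk k]

/-! ### Periodic measures and the locking criterion -/

/-- The point of the cylinder given by `e` that ends with zeros. -/
def zeroExt {M : ℕ} (e : Edge M) : Om := fun i => if h : i < M + 1 then e ⟨i, h⟩ else 0

@[simp] lemma window_zeroExt {M : ℕ} (e : Edge M) : window (M + 1) (zeroExt e) = e := by
  ext i
  simp [window, zeroExt, i.2]

/-- The uniform measure on the orbit of a point of period `L`. -/
def loopMeasure (p : Om) (L : ℕ) : Measure Om :=
  (L : ENNReal)⁻¹ • ∑ i ∈ Finset.range L, Measure.dirac (shift^[i] p)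

lemma sum_range_iterate_add {α : Type*} [AddCommMonoid α] {p : Om} {L : ℕ}
    (hp : shift^[L] p = p) (h : Om → α) (j : ℕ) :
    ∑ i ∈ Finset.range L, h (shift^[i] (shift^[j] p))
      = ∑ i ∈ Finset.range L, h (shift^[i] p) := by
  induction j with
  | zero => rfl
  | succ j ih =>
    rw [← ih]
    cases L with
    | zero => rfl
    | succ L =>
      rw [Finset.sum_range_succ, Finset.sum_range_succ']
      have h1 : shift^[L] (shift^[j + 1] p) = shift^[0] (shift^[j] p) := by
        rw [← Function.iterate_add_apply, show L + (j + 1) = j + (L + 1) by omega,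
          Function.iterate_add_apply, hp]
        rfl
      rw [h1]
      congr 1
      refine Finset.sum_congr rfl fun i _ => ?_
      rw [← Function.iterate_add_apply, ← Function.iterate_add_apply]
      congr 2
      omega

section LoopMeasure

variable {p : Om} {L : ℕ}

lemma loopMeasure_apply {s : Set Om} (hs : MeasurableSet s) :
    loopMeasure p L s
      = (L : ENNReal)⁻¹ * ∑ i ∈ Finset.range L, s.indicator (fun _ => 1) (shift^[i] p) := by
  simp only [loopMeasure, Measure.smul_apply, Measure.finsetSum_apply, smul_eq_mul]
  congr 1
  refine Finset.sum_congr rfl fun i _ => ?_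
  rw [Measure.dirac_apply' _ hs]
  rfl

lemma integral_loopMeasure (h : Om → ℝ) :
    ∫ x, h x ∂loopMeasure p L = (∑ i ∈ Finset.range L, h (shift^[i] p)) / L := by
  rw [loopMeasure, integral_smul_measure, integral_finsetSum_measure]
  · simp [div_eq_inv_mul]
  · exact fun i _ => integrable_dirac (by simp)

lemma loopMeasure_mem_invMeasures (hL : 0 < L) (hp : shift^[L] p = p) :
    loopMeasure p L ∈ invMeasures shift := by
  have hL0 : (L : ENNReal) ≠ 0 := by exact_mod_cast hL.ne'
  refine ⟨⟨?_⟩, continuous_shift.measurable, ?_⟩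
  · rw [loopMeasure_apply MeasurableSet.univ]
    simp [ENNReal.inv_mul_cancel hL0]
  · ext s hs
    rw [Measure.map_apply continuous_shift.measurable hs, loopMeasure_apply hs,
      loopMeasure_apply (continuous_shift.measurable hs),
      ← sum_range_iterate_add hp (s.indicator fun _ => 1) 1]
    congr 1
    refine Finset.sum_congr rfl fun i _ => ?_
    rw [← Function.iterate_add_apply, Function.iterate_succ_apply']
    rfl

lemma isPeriodicMeasure_loopMeasure (hL : 0 < L) (hp : shift^[L] p = p) :
    IsPeriodicMeasure shift (loopMeasure p L) := by
  refine ⟨loopMeasure_mem_invMeasures hL hp, p, Function.mk_mem_periodicPts hL hp, ?_⟩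
  rw [loopMeasure_apply (Set.countable_range _).measurableSet.compl]
  simp

/-- An invariant probability measure carried by a periodic orbit is the uniform measure on it. -/
lemma eq_loopMeasure {ν : Measure Om} (hν : ν ∈ invMeasures shift) (hL : 0 < L)
    (hp : shift^[L] p = p) (h : ∀ᵐ x ∂ν, ∃ j, x = shift^[j] p) : ν = loopMeasure p L := by
  have := hν.1
  have hL0 : (L : ENNReal) ≠ 0 := by exact_mod_cast hL.ne'
  ext s hs
  rw [loopMeasure_apply hs]
  set I : Om → ENNReal := s.indicator fun _ => 1 with hI
  have hIm : Measurable I := measurable_const.indicator hs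
  -- The sum over one period is integrated twice: by invariance it gives `L * ν s`, and on the orbit
  -- it is constant.
  have h1 : ∫⁻ x, ∑ i ∈ Finset.range L, I (shift^[i] x) ∂ν = L * ν s := by
    have hm : ∀ i, Measurable fun x => I (shift^[i] x) := fun i =>
      hIm.comp (hν.2.iterate i).measurable
    rw [lintegral_finsetSum _ fun i _ => hm i]
    have h2 : ∀ i, ∫⁻ x, I (shift^[i] x) ∂ν = ν s := fun i => by
      rw [(hν.2.iterate i).lintegral_comp hIm, hI, lintegral_indicator hs]
      simp
    simp [h2]
  have h3 : ∫⁻ x, ∑ i ∈ Finset.range L, I (shift^[i] x) ∂ν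
      = ∑ i ∈ Finset.range L, I (shift^[i] p) := by
    rw [lintegral_congr_ae (g := fun _ => ∑ i ∈ Finset.range L, I (shift^[i] p))]
    · simp
    · filter_upwards [h] with x hx
      obtain ⟨j, rfl⟩ := hx
      exact sum_range_iterate_add hp I j
  rw [← h3, h1, ← mul_assoc, ENNReal.inv_mul_cancel hL0 (by simp), one_mul]

end LoopMeasure

lemma cycleMean_le_add {M : ℕ} {F G : Edge M → ℝ} {C : Finset (Edge M)} {r : ℝ}
    (hC : C ∈ simpleCycles M) (h : ∀ e ∈ C, F e ≤ G e + r) :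
    cycleMean F C ≤ cycleMean G C + r := by
  obtain ⟨p, L, hp, rfl⟩ := mem_simpleCycles.1 hC
  have hc : (0 : ℝ) < (loopEdges M p L).card := by
    rw [hp.card_loopEdges]; exact_mod_cast hp.pos
  rw [cycleMean, cycleMean, div_add' _ _ _ hc.ne', div_le_div_iff_of_pos_right hc]
  refine (Finset.sum_le_sum h).trans_eq ?_
  rw [Finset.sum_add_distrib]
  simp [mul_comm]

section Locking

variable {M L : ℕ} {p : Om}

/-- A point whose itinerary stays in a simple loop shadows the orbit of this loop. -/
lemma IsSimpleLoop.window_shadow (hp : IsSimpleLoop M p L) {x : Om} {i₀ k : ℕ}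
    (h0 : window (M + 1) x = window (M + 1) (shift^[i₀] p))
    (hk : ∀ j ≤ k, window (M + 1) (shift^[j] x) ∈ loopEdges M p L) :
    ∀ j ≤ k, window (M + 1) (shift^[j] x) = window (M + 1) (shift^[j] (shift^[i₀] p)) := by
  intro j
  induction j with
  | zero => intro _; exact h0
  | succ j ih =>
    intro hj
    have h1 := window_shift_eq_of_window_succ_eq (ih (by omega))
    rw [← Function.iterate_succ_apply' shift, ← Function.iterate_succ_apply' shift] at h1
    obtain ⟨i, hi, hie⟩ := Finset.mem_image.1 (hk (j + 1) hj)
    rw [Finset.mem_range] at hi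
    have hper : shift^[j + 1] (shift^[i₀] p) = shift^[(j + 1 + i₀) % L] p := by
      rw [← Function.iterate_add_apply]
      exact (Function.IsPeriodicPt.iterate_mod_apply (f := shift) hp.period _).symm
    -- A simple loop visits each vertex once per period, so the vertex reached determines the time
    -- modulo `L`, hence the next edge.
    have h2 : i = (j + 1 + i₀) % L := by
      refine hp.inj hi (Nat.mod_lt _ hp.pos) ?_
      change window M _ = window M _
      rw [window_eq_of_window_succ_eq hie, h1, hper]
    rw [hper, ← h2, ← hie]

/-- The `k + 1` overlapping windows of length `M + 1` cover `M + 1 + k` symbols. -/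
lemma IsSimpleLoop.eq_of_shadow (hp : IsSimpleLoop M p L) {x : Om} {i₀ k : ℕ}
    (h0 : window (M + 1) x = window (M + 1) (shift^[i₀] p))
    (hk : ∀ j ≤ k, window (M + 1) (shift^[j] x) ∈ loopEdges M p L) :
    ∀ i < M + 1 + k, x i = shift^[i₀] p i := by
  intro i hi
  have h := hp.window_shadow h0 hk
  by_cases hik : i ≤ k
  · have := window_eq_iff.1 (h i hik) 0 (by omega)
    rw [shift_iterate_apply, shift_iterate_apply] at this
    simpa using this
  · have := window_eq_iff.1 (h k le_rfl) (i - k) (by omega)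
    rw [shift_iterate_apply, shift_iterate_apply, Nat.sub_add_cancel (by omega)] at this
    exact this

lemma integrable_comp_window {μ : Measure Om} (hμ : μ ∈ invMeasures shift) (F : Edge M → ℝ)
    (j : ℕ) : Integrable (fun x => F (window (M + 1) (shift^[j] x))) μ := by
  have := hμ.1
  refine Integrable.of_bound (C := ∑ e, |F e|) ?_ (Eventually.of_forall fun x => ?_)
  · exact ((measurable_of_finite F).comp
      ((measurable_window _).comp (hμ.2.iterate j).measurable)).aestronglyMeasurable
  · exact Finset.single_le_sum (f := fun e => |F e|) (fun _ _ => abs_nonneg _) (Finset.mem_univ _)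

variable {a : ℕ → ℝ} {K : ℝ}

/-- If the loop of `p` beats all other simple cycles by a margin that is large compared with the
regularity of `g` at the scale of the edges, then its periodic measure uniquely maximizes `g`. -/
lemma IsSimpleLoop.isUniqueMaximizing_of_gap (ha : Evanescent a)
    (hK : ∀ m k, ∑ j ∈ Finset.range k, a (m + j) ≤ K * a m) {g : C(Om, ℝ)} {Λ ε : ℝ}
    (hg : Λ ∈ lipBounds a g) (hp : IsSimpleLoop M p L)
    (hgap : ∀ D ∈ simpleCycles M, D ≠ loopEdges M p L →
      cycleMean (fun e => g (zeroExt e)) D + ε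
        ≤ cycleMean (fun e => g (zeroExt e)) (loopEdges M p L))
    (hε : (2 + K) * Λ * a (M + 1) < ε) :
    IsUniqueMaximizing shift g (loopMeasure p L) := by
  classical
  set C := loopEdges M p L with hC
  set r := Λ * a (M + 1) with hr
  -- Here `r` bounds the oscillation of `g` on an edge cylinder. One `r` is lost on the loop and one
  -- on its competitor when sample points are exchanged for orbit points.
  set ε' := ε - 2 * r with hε'
  have hΛ := hg.1
  have hr0 : 0 ≤ r := mul_nonneg hΛ (ha.pos _).le
  have hK0 : 0 ≤ K := by
    have := hK 0 0
    simp only [Finset.range_zero, Finset.sum_empty] at this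
    exact nonneg_of_mul_nonneg_left this (ha.pos _)
  have hδ : 0 < ε' - Λ * (K * a (M + 1)) := by rw [hε', hr]; linarith
  have hε0 : 0 ≤ ε' := by
    have := mul_nonneg hΛ (mul_nonneg hK0 (ha.pos (M + 1)).le); linarith
  have hclose : ∀ x y, (window (M + 1) x = window (M + 1) y) → g x ≤ g y + r := fun x y h => by
    have h1 := hg.2 x y
    have h2 := mul_le_mul_of_nonneg_left (ha.seqDist_le (window_eq_iff.1 h)) hΛ
    linarith [le_abs_self (g x - g y)]
  have hsel : ∀ e, ∃ i, e ∈ C → i < L ∧ window (M + 1) (shift^[i] p) = e := fun e => by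
    by_cases he : e ∈ C
    · obtain ⟨i, hi, hie⟩ := Finset.mem_image.1 he
      exact ⟨i, fun _ => ⟨Finset.mem_range.1 hi, hie⟩⟩
    · exact ⟨0, fun h => absurd h he⟩
  choose sel hsel using hsel
  -- On the loop, `F` takes the exact values of `g` along the orbit, so the mean over `C` is `β`.
  -- Off the loop it is raised by the spare margin `ε'`, and the gap still keeps every other mean at
  -- most `β`.
  set F : Edge M → ℝ := fun e =>
    if e ∈ C then g (shift^[sel e] p) else g (zeroExt e) + r + ε' with hF
  set I : Edge M → ℝ := fun e => if e ∈ C then 0 else 1 with hI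
  have hI0 : ∀ e, 0 ≤ I e := fun e => by simp only [hI]; split_ifs <;> norm_num
  set β := (∑ i ∈ Finset.range L, g (shift^[i] p)) / L with hβ
  have hCmem : C ∈ simpleCycles M := hp.mem_simpleCycles
  have hFC : cycleMean F C = β := by
    rw [hC, hp.cycleMean_eq, hβ]
    congr 1
    refine Finset.sum_congr rfl fun i hi => ?_
    have hmem : window (M + 1) (shift^[i] p) ∈ C := Finset.mem_image_of_mem _ hi
    simp only [hF, if_pos hmem]
    obtain ⟨h1, h2⟩ := hsel _ hmem
    rw [hp.injOn_edges (by simpa using h1) (by simpa using hi) h2]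
  have hwF : cycleMean (fun e => g (zeroExt e)) C ≤ cycleMean F C + r := by
    refine cycleMean_le_add hCmem fun e he => ?_
    simp only [hF, if_pos he]
    exact hclose _ _ (by rw [(hsel e he).2, window_zeroExt])
  have hall : ∀ D ∈ simpleCycles M, cycleMean F D ≤ β := by
    intro D hD
    by_cases hDC : D = C
    · rw [hDC, hFC]
    · have h1 : cycleMean F D ≤ cycleMean (fun e => g (zeroExt e)) D + (r + ε') := by
        refine cycleMean_le_add hD fun e _ => ?_
        simp only [hF]
        split_ifs with he
        · linarith [hclose (shift^[sel e] p) (zeroExt e) (by rw [(hsel e he).2, window_zeroExt])]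
        · linarith
      have h2 := hgap D hD hDC
      linarith
  obtain ⟨K', hK'⟩ := exists_birkhoffSum_le hall
  -- Each visit off the loop earns `ε'`. On the loop, the error is at most `Λ` times the distance to
  -- the shadowing orbit point, which is bounded by the term of the first exit, or by `a (M + 1 +
  -- T)` if there is no exit up to time `T`.
  have hpt : ∀ (T : ℕ) x, g x ≤ F (window (M + 1) x) - ε' * I (window (M + 1) x)
      + Λ * (∑ j ∈ Finset.range T, a (M + 1 + j) * I (window (M + 1) (shift^[j + 1] x))
        + a (M + 1 + T)) := by
    intro T x
    have hsum : ∀ j, 0 ≤ a (M + 1 + j) * I (window (M + 1) (shift^[j + 1] x)) := fun j =>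
      mul_nonneg (ha.pos _).le (hI0 _)
    by_cases hx : window (M + 1) x ∈ C
    · obtain ⟨h1, h2⟩ := hsel _ hx
      simp only [hF, hI, if_pos hx]
      set q := shift^[sel (window (M + 1) x)] p
      have hd : seqDist a x q
          ≤ ∑ j ∈ Finset.range T, a (M + 1 + j) * I (window (M + 1) (shift^[j + 1] x))
            + a (M + 1 + T) := by
        by_cases hex : ∃ j, j < T ∧ window (M + 1) (shift^[j + 1] x) ∉ C
        · have hj := Nat.find_spec hex
          have hmin : ∀ i < Nat.find hex, ¬(i < T ∧ window (M + 1) (shift^[i + 1] x) ∉ C) :=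
            fun i hi => Nat.find_min hex hi
          generalize Nat.find hex = j at hj hmin
          have h3 : seqDist a x q ≤ a (M + 1 + j) := by
            refine ha.seqDist_le (hp.eq_of_shadow h2.symm fun i hi => ?_)
            cases i with
            | zero => exact hx
            | succ i =>
              have := hmin i (by omega)
              push Not at this
              exact this (by omega)
          have h4 := Finset.single_le_sum (fun i _ => hsum i) (Finset.mem_range.2 hj.1)
          simp only [hI, if_neg hj.2, mul_one] at h4
          linarith [ha.pos (M + 1 + T)]
        · push Not at hex
          have h3 : seqDist a x q ≤ a (M + 1 + T) := by
            refine ha.seqDist_le (hp.eq_of_shadow h2.symm fun i hi => ?_)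
            cases i with
            | zero => exact hx
            | succ i => exact hex i (by omega)
          linarith [Finset.sum_nonneg fun i (_ : i ∈ Finset.range T) => hsum i]
      have h5 := mul_le_mul_of_nonneg_left hd hΛ
      simp only [hI] at h5
      linarith [hg.2 x q, le_abs_self (g x - g q)]
    · have h1 := hclose x (zeroExt (window (M + 1) x)) (by rw [window_zeroExt])
      have h2 : 0 ≤ Λ * (∑ j ∈ Finset.range T,
          a (M + 1 + j) * I (window (M + 1) (shift^[j + 1] x)) + a (M + 1 + T)) :=
        mul_nonneg hΛ (add_nonneg (Finset.sum_nonneg fun j _ => hsum j) (ha.pos _).le)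
      have h3 : F (window (M + 1) x) - ε' * I (window (M + 1) x)
          = g (zeroExt (window (M + 1) x)) + r := by
        simp only [hF, hI, if_neg hx]; ring
      linarith
  -- By invariance all the exit terms have the same integral `m`, so the shadowing errors total at
  -- most `Λ * K * a (M + 1) * m`, which the earned `ε' * m` outweighs.
  have hint : ∀ μ ∈ invMeasures shift, ∫ x, g x ∂μ
      ≤ β - (ε' - Λ * (K * a (M + 1))) * ∫ x, I (window (M + 1) x) ∂μ := by
    intro μ hμ
    have := hμ.1
    set m := ∫ x, I (window (M + 1) x) ∂μ with hm
    have hm0 : 0 ≤ m := integral_nonneg fun x => hI0 _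
    have hFβ : ∫ x, F (window (M + 1) x) ∂μ ≤ β :=
      integral_le_of_birkhoffSum_le hμ (G := fun x => F (window (M + 1) x))
        ((measurable_of_finite F).comp (measurable_window _)) (R := ∑ e, |F e|)
        (fun x => Finset.single_le_sum (f := fun e => |F e|) (fun _ _ => abs_nonneg _)
          (Finset.mem_univ _)) hK'
    have hIj : ∀ j, ∫ x, I (window (M + 1) (shift^[j] x)) ∂μ = m := fun j =>
      integral_comp_iterate hμ (G := fun x => I (window (M + 1) x))
        ((measurable_of_finite I).comp (measurable_window _)) j
    have hT : ∀ T : ℕ, ∫ x, g x ∂μ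
        ≤ β - (ε' - Λ * (K * a (M + 1))) * m + Λ * a (M + 1 + T) := by
      intro T
      have hiF := integrable_comp_window hμ F 0
      have hiI := fun j => integrable_comp_window hμ I j
      have hi1 := hiF.sub ((hiI 0).const_mul ε')
      have hi2 := integrable_finsetSum (Finset.range T) fun j _ =>
        (hiI (j + 1)).const_mul (a (M + 1 + j))
      have hi3 := (hi2.add (integrable_const (a (M + 1 + T)))).const_mul Λ
      have h1 : ∫ x, g x ∂μ ≤ ∫ x, _ ∂μ := integral_mono
        (g.continuous.integrable_of_hasCompactSupport (HasCompactSupport.of_compactSpace _))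
        (hi1.add hi3) (hpt T)
      have h2 : ∫ x, (F (window (M + 1) x) - ε' * I (window (M + 1) x)
          + Λ * (∑ j ∈ Finset.range T, a (M + 1 + j) * I (window (M + 1) (shift^[j + 1] x))
            + a (M + 1 + T))) ∂μ = ∫ x, F (window (M + 1) x) ∂μ - ε' * m
              + Λ * (∑ j ∈ Finset.range T, a (M + 1 + j) * m + a (M + 1 + T)) := by
        refine (integral_add hi1 hi3).trans ?_
        congr 1
        · refine (integral_sub hiF ((hiI 0).const_mul ε')).trans ?_
          rw [integral_const_mul]
          rfl
        · rw [integral_const_mul]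
          congr 1
          refine (integral_add hi2 (integrable_const _)).trans ?_
          congr 1
          · rw [integral_finsetSum _ fun j _ => (hiI (j + 1)).const_mul (a (M + 1 + j))]
            simp only [integral_const_mul, hIj]
          · simp
      have h3 : ∑ j ∈ Finset.range T, a (M + 1 + j) * m ≤ K * a (M + 1) * m := by
        rw [← Finset.sum_mul]
        exact mul_le_mul_of_nonneg_right (hK _ _) hm0
      have h4 := mul_le_mul_of_nonneg_left h3 hΛ
      refine h1.trans (h2.le.trans ?_)
      linarith
    have hlim : Tendsto (fun T : ℕ => β - (ε' - Λ * (K * a (M + 1))) * m + Λ * a (M + 1 + T))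
        atTop (𝓝 (β - (ε' - Λ * (K * a (M + 1))) * m + Λ * 0)) := by
      refine ((Tendsto.const_mul Λ (ha.tendsto_zero.comp ?_))).const_add _
      exact tendsto_atTop_mono (fun T => Nat.le_add_left T (M + 1)) tendsto_id
    simpa using ge_of_tendsto' hlim hT
  have hle : ∀ μ ∈ invMeasures shift, ∫ x, g x ∂μ ≤ β := fun μ hμ => by
    have h1 : 0 ≤ ∫ x, I (window (M + 1) x) ∂μ := integral_nonneg fun x => hI0 _
    linarith [hint μ hμ, mul_nonneg hδ.le h1]
  have hmem := loopMeasure_mem_invMeasures hp.pos hp.period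
  have hsup : ergSup shift g = β := by
    refine le_antisymm (csSup_le ⟨_, _, hmem, rfl⟩ ?_) ?_
    · rintro _ ⟨μ, hμ, rfl⟩
      exact hle μ hμ
    · rw [hβ, ← integral_loopMeasure]
      refine le_csSup ⟨β, ?_⟩ ⟨_, hmem, rfl⟩
      rintro _ ⟨μ, hμ, rfl⟩
      exact hle μ hμ
  refine ⟨⟨hmem, by rw [hsup, integral_loopMeasure]⟩, fun ν hν => ?_⟩
  obtain ⟨hνi, hνm⟩ := hν
  have := hνi.1
  -- A maximizing measure gives no mass to the edges off the loop, so almost every point follows the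
  -- loop forever and lies on the orbit.
  have h0 : ∫ x, I (window (M + 1) x) ∂ν = 0 := by
    refine le_antisymm ?_ (integral_nonneg fun x => hI0 _)
    have h1 := hint ν hνi
    rw [hνm, hsup] at h1
    by_contra! hpos
    linarith [mul_pos hδ hpos]
  have hae : ∀ᵐ x ∂ν, window (M + 1) x ∈ C := by
    have h1 := (integral_eq_zero_iff_of_nonneg (fun x => hI0 _)
      (integrable_comp_window hνi I 0)).1 h0
    filter_upwards [h1] with x hx
    by_contra hxC
    simp [hI, hxC] at hx
  have hae' : ∀ᵐ x ∂ν, ∀ j, window (M + 1) (shift^[j] x) ∈ C :=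
    ae_all_iff.2 fun j => (hνi.2.iterate j).quasiMeasurePreserving.ae hae
  refine eq_loopMeasure hνi hp.pos hp.period ?_
  filter_upwards [hae'] with x hx
  refine ⟨sel (window (M + 1) x), funext fun i => ?_⟩
  exact hp.eq_of_shadow (hsel _ (hx 0)).2.symm (k := i) (fun j _ => hx j) i (by omega)

/-- If one simple cycle beats all others by a sufficient margin, then `f` is locked. -/
lemma mem_lockingSet_of_gap (ha : Evanescent a)
    (hK : ∀ m k, ∑ j ∈ Finset.range k, a (m + j) ≤ K * a m) {f : LipSpace a} {Λ ε : ℝ}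
    (hΛ : ‖f‖ < Λ) {C : Finset (Edge M)} (hC : C ∈ simpleCycles M)
    (hgap : ∀ D ∈ simpleCycles M, D ≠ C →
      cycleMean (fun e => f.toC (zeroExt e)) D + ε ≤ cycleMean (fun e => f.toC (zeroExt e)) C)
    (hε : (2 + K) * Λ * a (M + 1) < ε) : f ∈ lockingSet a := by
  obtain ⟨p, L, hp, rfl⟩ := mem_simpleCycles.1 hC
  -- The first bound keeps the Lipschitz constant at most `Λ`. The perturbation moves each mean by
  -- at most `η`, so the gap loses `2 * η`; dividing by `3` keeps the inequality strict.
  set η := min (Λ - ‖f‖) ((ε - (2 + K) * Λ * a (M + 1)) / 3) with hη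
  have hη0 : 0 < η := lt_min (by linarith) (by linarith)
  have key : ∀ g : LipSpace a, ‖g - f‖ < η →
      IsUniqueMaximizing shift g.toC (loopMeasure p L) := by
    intro g hgf
    have h1 : lipConst g ≤ Λ := by
      have h2 : ‖g‖ ≤ ‖g - f‖ + ‖f‖ := by simpa using norm_add_le (g - f) f
      have h3 := min_le_left (Λ - ‖f‖) ((ε - (2 + K) * Λ * a (M + 1)) / 3)
      rw [← hη] at h3
      rw [LipSpace.norm_def g] at h2
      linarith [norm_nonneg g.toC]
    have hgΛ : Λ ∈ lipBounds a g.toC :=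
      ⟨(lipConst_mem g).1.trans h1, fun x y => ((lipConst_mem g).2 x y).trans
        (mul_le_mul_of_nonneg_right h1 (ha.seqDist_nonneg x y))⟩
    have hval : ∀ x, |g.toC x - f.toC x| ≤ η := fun x => by
      have h2 := (g - f).toC.norm_coe_le_norm x
      have h3 := (lipConst_mem (g - f)).1
      rw [LipSpace.norm_def] at hgf
      have h4 : (g - f).toC x = g.toC x - f.toC x := rfl
      rw [h4, Real.norm_eq_abs] at h2
      linarith
    have h5 := min_le_right (Λ - ‖f‖) ((ε - (2 + K) * Λ * a (M + 1)) / 3)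
    rw [← hη] at h5
    refine hp.isUniqueMaximizing_of_gap ha hK hgΛ (ε := ε - 2 * η) (fun D hD hDC => ?_) (by linarith)
    have h6 := hgap D hD hDC
    have h7 : cycleMean (fun e => g.toC (zeroExt e)) D
        ≤ cycleMean (fun e => f.toC (zeroExt e)) D + η :=
      cycleMean_le_add hD fun e _ => by linarith [(abs_le.1 (hval (zeroExt e))).2]
    have h8 : cycleMean (fun e => f.toC (zeroExt e)) (loopEdges M p L)
        ≤ cycleMean (fun e => g.toC (zeroExt e)) (loopEdges M p L) + η :=
      cycleMean_le_add hC fun e _ => by linarith [(abs_le.1 (hval (zeroExt e))).1]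
    linarith
  exact ⟨_, isPeriodicMeasure_loopMeasure hp.pos hp.period, key f (by simpa using hη0), η, hη0, key⟩

/-- Openness supplies the Borel measurability needed for the law of the series and for
transversality. -/
lemma isOpen_lockingSet (a : ℕ → ℝ) : IsOpen (lockingSet a) := by
  refine Metric.isOpen_iff.2 fun f hf => ?_
  obtain ⟨μ, hμ, -, ε, hε, h⟩ := hf
  refine ⟨ε, hε, fun g hg => ?_⟩
  rw [Metric.mem_ball, dist_eq_norm] at hg
  refine ⟨μ, hμ, h g hg, ε - ‖g - f‖, by linarith, fun k hk => h k ?_⟩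
  have : ‖k - f‖ ≤ ‖k - g‖ + ‖g - f‖ := norm_sub_le_norm_sub_add_norm_sub k g f
  linarith

end Locking

/-! ### Isolation of the best simple cycle -/

section Isolation

variable {M : ℕ}

/-- The word of length `M` at which the edge `e` starts. -/
def edgeWord (e : Edge M) : Word := prefixWord M (zeroExt e)

@[simp] lemma length_edgeWord (e : Edge M) : (edgeWord e).length = M := by simp [edgeWord]

lemma edgeWord_eq_iff {e e' : Edge M} :
    edgeWord e = edgeWord e' ↔ ∀ i : Fin M, e i.castSucc = e' i.castSucc := by
  have h : ∀ (e : Edge M) (i : Fin M), zeroExt e i = e i.castSucc := fun e i => by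
    simp only [zeroExt, dif_pos (Nat.lt_succ_of_lt i.2)]
    rfl
  unfold edgeWord prefixWord
  rw [List.ofFn_inj]
  simp [funext_iff, h]

lemma haar_edgeWord_zeroExt (e e' : Edge M) :
    haar (edgeWord e) (zeroExt e')
      = if edgeWord e = edgeWord e' then haarSign (e' (Fin.last M)) else 0 := by
  rw [haar_apply, length_edgeWord]
  have : zeroExt e' M = e' (Fin.last M) := by simp [zeroExt, Fin.last]
  rw [this]
  rfl

/-- A simple cycle leaves each vertex at most once, so `e` is its only edge in the support of this
Haar function. -/
lemma sum_haar_of_mem {C : Finset (Edge M)} (hC : C ∈ simpleCycles M) {e : Edge M} (he : e ∈ C) :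
    ∑ e' ∈ C, haar (edgeWord e) (zeroExt e') = haarSign (e (Fin.last M)) := by
  obtain ⟨p, L, hp, rfl⟩ := mem_simpleCycles.1 hC
  rw [Finset.sum_eq_single_of_mem e he, haar_edgeWord_zeroExt, if_pos rfl]
  intro e' he' hne
  rw [haar_edgeWord_zeroExt, if_neg]
  exact fun h => hne (hp.eq_of_init_eq he he' (edgeWord_eq_iff.1 h)).symm

/-- The only other edge leaving the same vertex carries the opposite Haar sign. -/
lemma sum_haar_of_notMem {C : Finset (Edge M)} {e : Edge M} (he : e ∉ C) :
    haarSign (e (Fin.last M)) * ∑ e' ∈ C, haar (edgeWord e) (zeroExt e') ≤ 0 := by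
  rw [Finset.mul_sum]
  refine Finset.sum_nonpos fun e' he' => ?_
  rw [haar_edgeWord_zeroExt]
  split_ifs with h
  · have hne : e (Fin.last M) ≠ e' (Fin.last M) := fun hl => he <| by
      have : e = e' := funext fun i =>
        Fin.lastCases (motive := fun i => e i = e' i) hl (edgeWord_eq_iff.1 h) i
      rwa [this]
    unfold haarSign
    split_ifs with h1 h2
    · exact absurd (h1.trans h2.symm) hne
    · norm_num
    · norm_num
    · exact absurd (by omega) hne
  · simp

/-- The mean of `f` over a simple cycle, evaluated at the points `zeroExt e`. -/
def zeroMean (f : C(Om, ℝ)) (C : Finset (Edge M)) : ℝ := cycleMean (fun e => f (zeroExt e)) C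

lemma zeroMean_add_smul (f h : C(Om, ℝ)) (t : ℝ) (C : Finset (Edge M)) :
    zeroMean (f + t • h) C = zeroMean f C + t * ((∑ e ∈ C, h (zeroExt e)) / C.card) := by
  simp only [zeroMean, cycleMean, ContinuousMap.add_apply, ContinuousMap.smul_apply, smul_eq_mul,
    Finset.sum_add_distrib, ← Finset.mul_sum]
  ring

/-- Two simple cycles, one through the edge `e` and the other not, are both optimal for `f` up to
an error `ε`. -/
def NearTie (f : C(Om, ℝ)) (e : Edge M) (ε : ℝ) : Prop :=
  ∃ C ∈ simpleCycles M, ∃ C' ∈ simpleCycles M, e ∈ C ∧ e ∉ C' ∧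
    ∀ D ∈ simpleCycles M, zeroMean f D ≤ zeroMean f C + ε ∧ zeroMean f D ≤ zeroMean f C' + ε

lemma simpleCycles_nonempty (M : ℕ) : (simpleCycles M).Nonempty := by
  obtain ⟨p, y, L, hp, -⟩ := exists_simpleLoop_excision M fun _ => 0
  exact ⟨_, hp.mem_simpleCycles⟩

/-- A rival within `ε` of the best cycle differs from it at some edge, which lies in exactly one of
the two and so witnesses a near tie. -/
lemma exists_gap_of_not_nearTie {f : C(Om, ℝ)} {ε : ℝ} (hε : 0 ≤ ε)
    (h : ∀ e : Edge M, ¬ NearTie f e ε) :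
    ∃ C ∈ simpleCycles M, ∀ D ∈ simpleCycles M, D ≠ C → zeroMean f D + ε ≤ zeroMean f C := by
  obtain ⟨C, hC, hmax⟩ := (simpleCycles M).exists_max_image (zeroMean f) (simpleCycles_nonempty M)
  refine ⟨C, hC, fun D hD hDC => ?_⟩
  by_contra! hlt
  have hb : ∀ B ∈ simpleCycles M, zeroMean f B ≤ zeroMean f C + ε ∧
      zeroMean f B ≤ zeroMean f D + ε := fun B hB => by
    have := hmax B hB
    constructor <;> linarith
  have hex : ∃ e, ¬(e ∈ D ↔ e ∈ C) := by
    by_contra! hall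
    exact hDC (Finset.ext hall)
  obtain ⟨e, he⟩ := hex
  by_cases heC : e ∈ C
  · exact h e ⟨C, hC, D, hD, heC, by tauto, hb⟩
  · exact h e ⟨D, hD, C, hC, by tauto, heC, fun B hB => (hb B hB).symm⟩

/-- Along the direction of the Haar function at the initial vertex of `e`, near ties for `e` occur
only on a short set of parameters. -/
lemma NearTie.abs_sub_le {f : C(Om, ℝ)} {e : Edge M} {ε s t : ℝ}
    (hs : NearTie (f + s • haar (edgeWord e)) e ε)
    (ht : NearTie (f + t • haar (edgeWord e)) e ε) : |s - t| ≤ 4 * 2 ^ M * ε := by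
  set σ := haarSign (e (Fin.last M)) with hσ
  have hσσ : σ * σ = 1 / 4 := by
    rw [← abs_mul_abs_self, hσ, abs_haarSign]; norm_num
  wlog hst : 0 ≤ σ * (t - s) generalizing s t
  · rw [abs_sub_comm]
    exact this ht hs (by push Not at hst; linarith)
  -- Only the cycle through `e` is kept from the tie at `s`, and only the cycle avoiding `e` from
  -- the tie at `t`. Comparing them at both parameters cancels the unknown means of `f`.
  obtain ⟨C, hC, _, _, heC, -, hCmax⟩ := hs
  obtain ⟨_, _, C', hC', -, heC', hCmax'⟩ := ht
  have h1 := (hCmax C' hC').1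
  have h2 := (hCmax' C hC).2
  rw [zeroMean_add_smul, zeroMean_add_smul] at h1 h2
  set κ' := (∑ e' ∈ C', haar (edgeWord e) (zeroExt e')) / (C'.card : ℝ) with hκ'
  rw [sum_haar_of_mem hC heC, ← hσ] at h1 h2
  have h3 : σ * κ' ≤ 0 := by
    rw [hκ', ← mul_div_assoc]
    exact div_nonpos_of_nonpos_of_nonneg (sum_haar_of_notMem heC') (Nat.cast_nonneg _)
  have h4 : (t - s) * κ' ≤ 0 := by
    have h5 : (t - s) * κ' = 4 * ((σ * (t - s)) * (σ * κ')) := by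
      linear_combination (-4 * (t - s) * κ') * hσσ
    rw [h5]
    linarith [mul_nonpos_of_nonneg_of_nonpos hst h3]
  obtain ⟨p, L, hp, rfl⟩ := mem_simpleCycles.1 hC
  have hL : (0 : ℝ) < (loopEdges M p L).card := by
    rw [hp.card_loopEdges]; exact_mod_cast hp.pos
  have hL2 : ((loopEdges M p L).card : ℝ) ≤ 2 ^ M := by
    rw [hp.card_loopEdges]; exact_mod_cast hp.le_two_pow
  have h6 : (t - s) * (σ / (loopEdges M p L).card) ≤ 2 * ε := by linarith
  rw [← mul_div_assoc, div_le_iff₀ hL] at h6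
  have h7 : |s - t| = 2 * (σ * (t - s)) := by
    rw [abs_sub_comm, ← abs_of_nonneg hst, abs_mul, hσ, abs_haarSign]
    ring
  have hε : 0 ≤ ε := by
    have := (hCmax _ hC).1
    linarith
  rw [h7]
  have := mul_le_mul_of_nonneg_left hL2 hε
  linarith

lemma lipSpace_continuous_eval (a : ℕ → ℝ) (x : Om) :
    Continuous fun f : LipSpace a => f.toC x := by
  refine (LipschitzWith.of_dist_le_mul (K := 1) fun f g => ?_).continuous
  rw [dist_eq_norm, dist_eq_norm, NNReal.coe_one, one_mul, LipSpace.norm_def]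
  have h1 := (f - g).toC.norm_coe_le_norm x
  have h2 := (lipConst_mem (f - g)).1
  have h3 : (f - g).toC x = f.toC x - g.toC x := rfl
  rw [h3] at h1
  linarith

lemma continuous_zeroMean (a : ℕ → ℝ) (C : Finset (Edge M)) :
    Continuous fun f : LipSpace a => zeroMean f.toC C := by
  unfold zeroMean cycleMean
  exact (continuous_finsetSum _ fun e _ => lipSpace_continuous_eval a _).div_const _

lemma isClosed_nearTie (a : ℕ → ℝ) (e : Edge M) (ε : ℝ) :
    IsClosed {f : LipSpace a | NearTie f.toC e ε} := by
  have h : {f : LipSpace a | NearTie f.toC e ε} = ⋃ C ∈ {C | C ∈ simpleCycles M ∧ e ∈ C},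
      ⋃ C' ∈ {C' | C' ∈ simpleCycles M ∧ e ∉ C'}, ⋂ D ∈ simpleCycles M,
        {f : LipSpace a | zeroMean f.toC D ≤ zeroMean f.toC C + ε} ∩
          {f : LipSpace a | zeroMean f.toC D ≤ zeroMean f.toC C' + ε} := by
    ext f
    simp only [NearTie, Set.mem_ofPred_eq, Set.mem_iUnion, Set.mem_iInter, Set.mem_inter_iff,
      exists_prop]
    constructor
    · rintro ⟨C, hC, C', hC', he, he', h⟩
      exact ⟨C, ⟨hC, he⟩, C', ⟨hC', he'⟩, h⟩
    · rintro ⟨C, ⟨hC, he⟩, C', ⟨hC', he'⟩, h⟩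
      exact ⟨C, hC, C', hC', he, he', h⟩
  rw [h]
  refine (Set.toFinite _).isClosed_biUnion fun C _ => (Set.toFinite _).isClosed_biUnion fun C' _ =>
    isClosed_biInter fun D _ => ?_
  exact (isClosed_le (continuous_zeroMean a D) ((continuous_zeroMean a C).add_const ε)).inter
    (isClosed_le (continuous_zeroMean a D) ((continuous_zeroMean a C').add_const ε))

end Isolation

/-! ### Resampling one coordinate of a product measure -/

section Resampling

variable {ι : Type*} [DecidableEq ι] {X : ι → Type*} [∀ i, MeasurableSpace (X i)]
  (μ : ∀ i, Measure (X i)) [∀ i, IsProbabilityMeasure (μ i)]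

lemma measurable_update_prod (i : ι) :
    Measurable fun q : (∀ j, X j) × X i => Function.update q.1 i q.2 := by
  refine measurable_pi_iff.2 fun j => ?_
  by_cases h : j = i
  · subst h
    simpa using measurable_snd
  · simp only [Function.update_of_ne h]
    exact (measurable_pi_apply j).comp measurable_fst

/-- By independence, replacing one coordinate by a fresh copy with the same law does not change the
product law. -/
lemma map_update_infinitePi (i : ι) :
    ((Measure.infinitePi μ).prod (μ i)).map (fun q => Function.update q.1 i q.2)
      = Measure.infinitePi μ := by
  refine Measure.eq_infinitePi μ fun s t ht => ?_
  rw [Measure.map_apply (measurable_update_prod i)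
    (MeasurableSet.pi s.countable_toSet fun j _ => ht j)]
  have h : (fun q : (∀ j, X j) × X i => Function.update q.1 i q.2) ⁻¹' (s : Set ι).pi t
      = ((s.erase i : Finset ι) : Set ι).pi t ×ˢ (if i ∈ s then t i else Set.univ) := by
    ext q
    simp only [Set.mem_preimage, Set.mem_pi, Set.mem_prod, Finset.mem_coe, Finset.mem_erase]
    constructor
    · intro hq
      refine ⟨fun j hj => by simpa [Function.update_of_ne hj.1] using hq j hj.2, ?_⟩
      split_ifs with hi
      · simpa using hq i hi
      · trivial
    · rintro ⟨h1, h2⟩ j hj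
      by_cases hji : j = i
      · subst hji
        simpa [hj] using h2
      · simpa [Function.update_of_ne hji] using h1 j ⟨hji, hj⟩
  rw [h, Measure.prod_prod, Measure.infinitePi_pi μ fun j _ => ht j]
  split_ifs with hi
  · rw [mul_comm, Finset.mul_prod_erase s (fun j => μ j (t j)) hi]
  · rw [Finset.erase_eq_of_notMem hi, measure_univ, mul_one]

/-- Fubini after resampling: a bound on all one-dimensional fibres bounds the whole set. -/
lemma infinitePi_le_of_update_le (i : ι) {S : Set (∀ j, X j)} (hS : MeasurableSet S)
    {B : ENNReal} (h : ∀ c, μ i {t | Function.update c i t ∈ S} ≤ B) :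
    Measure.infinitePi μ S ≤ B := by
  rw [← map_update_infinitePi μ i, Measure.map_apply (measurable_update_prod i) hS,
    Measure.prod_apply (measurable_update_prod i hS)]
  refine (lintegral_mono fun c => h c).trans ?_
  simp

end Resampling

/-! ### The brick measure -/

lemma isProbabilityMeasure_cond_gauge {b : Word → ℝ} (hb : ∀ w, 0 < b w) (w : Word) :
    IsProbabilityMeasure (ProbabilityTheory.cond volume (Set.Icc (-b w) (b w))) :=
  isProbabilityMeasure_cond_Icc (hb w)

section Brick

variable {a : ℕ → ℝ} {b : Word → ℝ}

lemma isProbabilityMeasure_coeffMeasure (hb : ∀ w, 0 < b w) :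
    IsProbabilityMeasure (coeffMeasure b) := by
  have := isProbabilityMeasure_cond_gauge hb
  unfold coeffMeasure
  infer_instance

lemma ae_mem_coeffBox (hb : ∀ w, 0 < b w) : ∀ᵐ c ∂coeffMeasure b, c ∈ coeffBox b := by
  have := isProbabilityMeasure_cond_gauge hb
  refine ae_all_iff.2 fun w => ?_
  have h1 : ∀ᵐ t ∂ProbabilityTheory.cond volume (Set.Icc (-b w) (b w)), |t| ≤ b w := by
    filter_upwards [ProbabilityTheory.ae_cond_mem measurableSet_Icc] with t ht
    exact abs_le.2 ht
  exact (measurePreserving_eval_infinitePi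
    (fun w => ProbabilityTheory.cond volume (Set.Icc (-b w) (b w))) w).quasiMeasurePreserving.ae h1

lemma measurableSet_coeffBox (b : Word → ℝ) : MeasurableSet (coeffBox b) :=
  (isCompact_coeffBox b).isClosed.measurableSet

lemma aemeasurable_haarSeries (ha : Evanescent a) (hb : AdmissibleGauge a b) :
    AEMeasurable (haarSeries a) (coeffMeasure b) := by
  have h := (continuousOn_haarSeries ha hb).aemeasurable (μ := coeffMeasure b)
    (measurableSet_coeffBox b)
  rwa [Measure.restrict_eq_self_of_ae_mem (ae_mem_coeffBox hb.pos)] at h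

lemma isProbabilityMeasure_brickMeasure (ha : Evanescent a) (hb : AdmissibleGauge a b) :
    IsProbabilityMeasure (brickMeasure a b) := by
  have := isProbabilityMeasure_coeffMeasure hb.pos
  exact Measure.isProbabilityMeasure_map (aemeasurable_haarSeries ha hb)

lemma measurableSet_hilbertBrick (ha : Evanescent a) (hb : AdmissibleGauge a b) :
    MeasurableSet (hilbertBrick a b) :=
  (isCompact_hilbertBrick ha hb).isClosed.measurableSet

lemma ae_mem_hilbertBrick (ha : Evanescent a) (hb : AdmissibleGauge a b) :
    ∀ᵐ g ∂brickMeasure a b, g ∈ hilbertBrick a b := by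
  refine (ae_map_iff (aemeasurable_haarSeries ha hb) (measurableSet_hilbertBrick ha hb)).2 ?_
  filter_upwards [ae_mem_coeffBox hb.pos] with c hc
  exact ⟨c, hc, hasHaarSum_haarSeries ha hb hc⟩

lemma LipSpace.toC_add (f g : LipSpace a) : (f + g).toC = f.toC + g.toC := rfl

lemma toC_haarSeries_update (ha : Evanescent a) (hb : AdmissibleGauge a b) {c : Word → ℝ}
    {w : Word} {s t : ℝ} (hs : Function.update c w s ∈ coeffBox b)
    (ht : Function.update c w t ∈ coeffBox b) :
    (haarSeries a (Function.update c w t)).toC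
      = (haarSeries a (Function.update c w s)).toC + (t - s) • haar w := by
  have h1 := hasHaarSum_haarSeries ha hb ht
  have h2 := (hasHaarSum_haarSeries ha hb hs).add (hasHaarSum_single w (t - s))
  have h3 : Function.update c w s + Pi.single w (t - s) = Function.update c w t := by
    ext v
    by_cases h : v = w
    · subst h; simp
    · simp [Function.update_of_ne h, Pi.single_eq_of_ne h]
  rw [h3] at h2
  exact HasSum.unique h1 h2

/-! ### Probability of near ties and almost sure locking -/

lemma cond_Icc_le {r d : ℝ} (hr : 0 < r) {S : Set ℝ} (h : ∀ s ∈ S, ∀ t ∈ S, |s - t| ≤ d) :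
    ProbabilityTheory.cond volume (Set.Icc (-r) r) S ≤ ENNReal.ofReal (d / (2 * r)) := by
  rw [ProbabilityTheory.cond_apply measurableSet_Icc, Real.volume_Icc, sub_neg_eq_add, ← two_mul]
  have h1 : volume (Set.Icc (-r) r ∩ S) ≤ ENNReal.ofReal d := by
    refine (measure_mono Set.inter_subset_right).trans ((Real.volume_le_diam S).trans ?_)
    refine Metric.ediam_le fun s hs t ht => ?_
    rw [edist_dist, Real.dist_eq]
    exact ENNReal.ofReal_le_ofReal (h s hs t ht)
  rw [div_eq_inv_mul d, ENNReal.ofReal_mul (inv_nonneg.2 (by linarith)),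
    ENNReal.ofReal_inv_of_pos (by linarith)]
  gcongr

/-- Near ties at an edge are unlikely. -/
lemma coeffMeasure_nearTie_le (ha : Evanescent a) (hb : AdmissibleGauge a b) (f₀ : LipSpace a)
    {M : ℕ} (e : Edge M) (ε : ℝ) :
    coeffMeasure b {c | c ∈ coeffBox b ∧ NearTie (f₀ + haarSeries a c).toC e ε}
      ≤ ENNReal.ofReal (4 * 2 ^ M * ε / (2 * b (edgeWord e))) := by
  have := isProbabilityMeasure_cond_gauge hb.pos
  -- Continuity of `haarSeries` is available only on the box, so the event is cut down to the box,
  -- where it is closed.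
  have hmeas : MeasurableSet {c | c ∈ coeffBox b ∧ NearTie (f₀ + haarSeries a c).toC e ε} := by
    have hcont : ContinuousOn (fun c => f₀ + haarSeries a c) (coeffBox b) :=
      continuousOn_const.add (continuousOn_haarSeries ha hb)
    exact (hcont.preimage_isClosed_of_isClosed (isCompact_coeffBox b).isClosed
      (isClosed_nearTie a e ε)).measurableSet
  refine infinitePi_le_of_update_le _ (edgeWord e) hmeas fun c => ?_
  refine cond_Icc_le (hb.pos _) fun s hs t ht => ?_
  obtain ⟨hsb, hs⟩ := hs
  obtain ⟨htb, ht⟩ := ht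
  have h1 := toC_haarSeries_update ha hb hsb htb
  set f := (f₀ + haarSeries a (Function.update c (edgeWord e) s)).toC with hf
  have h2 : (f₀ + haarSeries a (Function.update c (edgeWord e) t)).toC
      = f + (t - s) • haar (edgeWord e) := by
    rw [hf, LipSpace.toC_add, LipSpace.toC_add, h1, add_assoc]
  rw [h2] at ht
  have h3 := NearTie.abs_sub_le (f := f) (s := 0) (by rwa [zero_smul, add_zero]) ht
  rwa [zero_sub, abs_neg, abs_sub_comm] at h3

/-- Union bound over the `2 ^ (M + 1)` edges; together with the cycle length bound `2 ^ M` this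
produces `4 ^ M`. -/
lemma coeffMeasure_exists_nearTie_le (ha : Evanescent a) (hb : AdmissibleGauge a b)
    (f₀ : LipSpace a) (M : ℕ) {ε : ℝ} (hε : 0 ≤ ε) :
    coeffMeasure b {c | c ∈ coeffBox b ∧ ∃ e : Edge M, NearTie (f₀ + haarSeries a c).toC e ε}
      ≤ ENNReal.ofReal (4 * 4 ^ M * ε / gaugeMin b M) := by
  have h : {c | c ∈ coeffBox b ∧ ∃ e : Edge M, NearTie (f₀ + haarSeries a c).toC e ε}
      ⊆ ⋃ e : Edge M, {c | c ∈ coeffBox b ∧ NearTie (f₀ + haarSeries a c).toC e ε} := by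
    rintro c ⟨hc, e, he⟩
    exact Set.mem_iUnion.2 ⟨e, hc, he⟩
  have hg := hb.gaugeMin_pos M
  refine (measure_mono h).trans ((measure_iUnion_fintype_le _ _).trans ?_)
  have h1 : ∀ e : Edge M,
      coeffMeasure b {c | c ∈ coeffBox b ∧ NearTie (f₀ + haarSeries a c).toC e ε}
        ≤ ENNReal.ofReal (4 * 2 ^ M * ε / (2 * gaugeMin b M)) := fun e => by
    refine (coeffMeasure_nearTie_le ha hb f₀ e ε).trans (ENNReal.ofReal_le_ofReal ?_)
    have h2 := gaugeMin_le b (edgeWord e)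
    rw [length_edgeWord] at h2
    gcongr
  refine (Finset.sum_le_sum fun e _ => h1 e).trans_eq ?_
  rw [Finset.sum_const, nsmul_eq_mul, ← ENNReal.ofReal_natCast, ← ENNReal.ofReal_mul (by positivity)]
  congr 1
  have h4 : (4 : ℝ) ^ M = 2 ^ M * 2 ^ M := by rw [← mul_pow]; norm_num
  simp only [Finset.card_univ, Fintype.card_pi, Fintype.card_fin, Finset.prod_const, h4]
  push_cast
  field_simp
  ring

lemma tendsto_exp_mul_div_two_pow (D : ℝ) :
    Tendsto (fun n : ℕ => Real.exp (D * n) * ((2 : ℝ) ^ 2 ^ (n + 2))⁻¹) atTop (𝓝 0) := by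
  have hlog : 0 < Real.log 2 := Real.log_pos one_lt_two
  have h1 : Tendsto (fun n : ℕ => (n : ℝ) ^ 1 / (2 : ℝ) ^ n) atTop (𝓝 0) :=
    tendsto_pow_const_div_const_pow_of_one_lt 1 one_lt_two
  have h2 : ∀ᶠ n : ℕ in atTop, D * n ≤ Real.log 2 * 2 ^ n := by
    have h3 := (h1.const_mul D).eventually_le_const
      (show D * 0 < Real.log 2 by simpa using hlog)
    filter_upwards [h3] with n hn
    rw [pow_one, ← mul_div_assoc, div_le_iff₀ (by positivity)] at hn
    exact hn
  have h4 : Tendsto (fun n : ℕ => Real.exp (-(Real.log 2 * 2 ^ n))) atTop (𝓝 0) :=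
    Real.tendsto_exp_neg_atTop_nhds_zero.comp
      ((tendsto_pow_atTop_atTop_of_one_lt one_lt_two).const_mul_atTop hlog)
  refine squeeze_zero' (Eventually.of_forall fun n => by positivity) ?_ h4
  filter_upwards [h2] with n hn
  have h5 : ((2 : ℝ) ^ 2 ^ (n + 2))⁻¹ = Real.exp (-(Real.log 2 * (4 * 2 ^ n))) := by
    rw [Real.exp_neg, Real.exp_mul, Real.exp_log two_pos, ← Real.rpow_natCast]
    congr 2
    push_cast
    ring
  rw [h5, ← Real.exp_add]
  refine Real.exp_le_exp.2 ?_
  have : 0 < Real.log 2 * 2 ^ n := by positivity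
  linarith

/-- Factor the quotient through `a n`: evanescence makes one factor doubly exponentially small, and
admissibility keeps the other at most exponentially large. -/
lemma tendsto_pow_mul_div_gaugeMin (ha : Evanescent a) (hb : AdmissibleGauge a b) :
    Tendsto (fun n : ℕ => (4 : ℝ) ^ n * (a (n + 1) / gaugeMin b n)) atTop (𝓝 0) := by
  obtain ⟨D, hD⟩ := hb.log_isBigO.bound
  obtain ⟨A, hA⟩ := ha.ratio.bound
  have hlim := (tendsto_exp_mul_div_two_pow (Real.log 4 + D)).const_mul A
  rw [mul_zero] at hlim
  refine squeeze_zero' (Eventually.of_forall fun n => ?_) ?_ hlim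
  · have := ha.pos (n + 1)
    have := hb.gaugeMin_pos n
    positivity
  filter_upwards [hD, hA] with n hDn hAn
  have han := ha.pos n
  have han1 := ha.pos (n + 1)
  have hg := hb.gaugeMin_pos n
  rw [Real.norm_eq_abs, Real.norm_eq_abs, Nat.abs_cast] at hDn
  rw [Real.norm_of_nonneg (by positivity), Real.norm_of_nonneg (by positivity)] at hAn
  have h1 : a n / gaugeMin b n ≤ Real.exp (D * n) := by
    rw [← Real.exp_log (show 0 < a n / gaugeMin b n by positivity)]
    exact Real.exp_le_exp.2 ((le_abs_self _).trans hDn)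
  have h2 : (4 : ℝ) ^ n = Real.exp (Real.log 4 * n) := by
    rw [Real.exp_mul, Real.exp_log (by norm_num), Real.rpow_natCast]
  calc (4 : ℝ) ^ n * (a (n + 1) / gaugeMin b n)
      = 4 ^ n * ((a (n + 1) / a n) * (a n / gaugeMin b n)) := by field_simp
    _ ≤ 4 ^ n * ((A * ((2 : ℝ) ^ 2 ^ (n + 2))⁻¹) * Real.exp (D * n)) := by
        gcongr
        exact (show 0 ≤ a (n + 1) / a n by positivity).trans hAn
    _ = A * (Real.exp ((Real.log 4 + D) * n) * ((2 : ℝ) ^ 2 ^ (n + 2))⁻¹) := by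
        rw [h2, add_mul, Real.exp_add]
        ring

lemma ae_add_haarSeries_mem_lockingSet (ha : Evanescent a) (hb : AdmissibleGauge a b)
    (f₀ : LipSpace a) : ∀ᵐ c ∂coeffMeasure b, f₀ + haarSeries a c ∈ lockingSet a := by
  obtain ⟨K, hK0, hK⟩ := ha.exists_sum_le
  obtain ⟨R, hR⟩ := exists_norm_haarSeries_le ha hb
  set Λ := ‖f₀‖ + |R| + 1 with hΛ
  have hΛ0 : 0 < Λ := by positivity
  -- The summand `1` makes the margin strictly larger than the threshold of the locking criterion.
  set A := (2 + K) * Λ + 1 with hA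
  have hA0 : 0 < A := by positivity
  -- The left side does not depend on `M`: failure to lock forces a near tie at every scale, so
  -- bounds tending to `0` suffice and no summability over scales is needed.
  have hsub : ∀ M : ℕ, {c | c ∈ coeffBox b ∧ f₀ + haarSeries a c ∉ lockingSet a}
      ⊆ {c | c ∈ coeffBox b ∧
          ∃ e : Edge M, NearTie (f₀ + haarSeries a c).toC e (A * a (M + 1))} := by
    rintro M c ⟨hc, hlock⟩
    refine ⟨hc, ?_⟩
    by_contra! hno
    have hpos := ha.pos (M + 1)
    obtain ⟨C, hC, hgap⟩ := exists_gap_of_not_nearTie (by positivity) hno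
    refine hlock (mem_lockingSet_of_gap ha hK (Λ := Λ) ?_ hC hgap ?_)
    · have := norm_add_le f₀ (haarSeries a c)
      linarith [hR c hc, le_abs_self R]
    · rw [hA, add_mul]
      linarith
  have hbound : ∀ M : ℕ, coeffMeasure b {c | c ∈ coeffBox b ∧ f₀ + haarSeries a c ∉ lockingSet a}
      ≤ ENNReal.ofReal (4 * A * (4 ^ M * (a (M + 1) / gaugeMin b M))) := fun M => by
    have hpos := ha.pos (M + 1)
    refine (measure_mono (hsub M)).trans
      ((coeffMeasure_exists_nearTie_le ha hb f₀ M (by positivity)).trans_eq ?_)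
    congr 1
    ring
  have hlim := ENNReal.tendsto_ofReal ((tendsto_pow_mul_div_gaugeMin ha hb).const_mul (4 * A))
  rw [mul_zero, ENNReal.ofReal_zero] at hlim
  have h0 := le_antisymm (ge_of_tendsto' hlim hbound) zero_le
  have h1 : ∀ᵐ c ∂coeffMeasure b, ¬(c ∈ coeffBox b ∧ f₀ + haarSeries a c ∉ lockingSet a) := by
    rw [ae_iff]
    simpa using h0
  filter_upwards [h1, ae_mem_coeffBox hb.pos] with c hc hcb
  by_contra h
  exact hc ⟨hcb, h⟩

lemma ae_add_mem_lockingSet (ha : Evanescent a) (hb : AdmissibleGauge a b) (f₀ : LipSpace a) :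
    ∀ᵐ g ∂brickMeasure a b, f₀ + g ∈ lockingSet a :=
  (ae_map_iff (aemeasurable_haarSeries ha hb) ((isOpen_lockingSet a).measurableSet.preimage
    (measurable_const_add f₀))).2 (ae_add_haarSeries_mem_lockingSet ha hb f₀)

lemma isTransverse_brickMeasure (ha : Evanescent a) (hb : AdmissibleGauge a b) :
    IsTransverse (brickMeasure a b) (lockingSet a)ᶜ where
  borel := (isOpen_lockingSet a).measurableSet.compl
  prob := isProbabilityMeasure_brickMeasure ha hb
  compactly_supported := ⟨_, isCompact_hilbertBrick ha hb, ae_mem_hilbertBrick ha hb⟩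
  null_translates v := by
    refine measure_mono_null ?_ (ae_iff.1 (ae_add_mem_lockingSet ha hb (-v)))
    rintro _ ⟨s, hs, rfl⟩
    simpa using hs

end Brick

end ErgOpt
end

open ErgOpt
theorem theorem1p3 (a : ℕ → ℝ) (b : Word → ℝ) (ha : Evanescent a) (hb : AdmissibleGauge a b) :
    -- the brick is well defined: each coefficient family in the box gives an element of `C^a(Ω)`
    (∀ c ∈ coeffBox b, ∃! f : LipSpace a, HasHaarSum c f.toC) ∧
    -- `P_b` is a probability measure carried by the compact brick
    IsCompact (hilbertBrick a b) ∧
    IsProbabilityMeasure (brickMeasure a b) ∧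
    brickMeasure a b (hilbertBrick a b) = 1 ∧
    -- almost every element of the brick moves `f₀` into the locking set
    (∀ f₀ : LipSpace a, brickMeasure a b {g | g ∈ hilbertBrick a b ∧ f₀ + g ∈ lockingSet a} = 1) ∧
    -- transversality
    IsTransverse (brickMeasure a b) (lockingSet a)ᶜ := by
  have hprob := isProbabilityMeasure_brickMeasure ha hb
  refine ⟨fun c hc => ⟨_, hasHaarSum_haarSeries ha hb hc, fun f hf => ?_⟩,
    isCompact_hilbertBrick ha hb, hprob, ?_, fun f₀ => ?_, isTransverse_brickMeasure ha hb⟩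
  · exact hf.unique (hasHaarSum_haarSeries ha hb hc)
  · have h := measure_congr (eventuallyEq_univ.2 (ae_mem_hilbertBrick ha hb))
    exact h.trans measure_univ
  · have h := measure_congr (eventuallyEq_univ.2
      ((ae_mem_hilbertBrick ha hb).and (ae_add_mem_lockingSet ha hb f₀)))
    exact h.trans measure_univ
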